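/- Offers for an asset arrive as a Poisson process of rate $\lambda>0$: the waiting times $D_1,D_2,\dots$ between offers are i.i.d. exponential with rate $\lambda$, the offers $X_1,X_2,\dots$ are i.i.d. with distribution function $F$, and a residual price $X_0$ is received if no offer has been accepted by the deadline; all these random variables are independent. Assume $E[\max(X_1,0)]<\infty$, $E|X_0|<\infty$ and $\mu_0:=E[X_0]\ge 0$. With time $t\ge 0$ to the deadline, the $i$-th offer arrives when the remaining time is $t_i=\max(t_{i-1}-D_i,0)$, $t_0=t$. A policy is a measurable rule that decides, from the remaining time and the value of an offer, whether to accept that offer; the sale price is the first accepted offer with $t_i>0$, and $X_0$ if there is none. Let $\mu(t)$ be the supremum of the expected sale price over all policies for which the sale price is integrable, and let $S_t$ be the sale price under the policy that accepts an offer $x$ at remaining time $s$ if and only if $x\ge\mu(s)$. Put $M=\sup\{x: F(x)<1\}$ and $\phi(x)=\int_x^\infty (1-F(u))\,du$. Theorem. Assume that $M=+\infty$ and that $$\lim_{x\to\infty}\frac{\phi(x)}{\int_x^\infty\phi(u)\,du}=c$$ for some $c>0$. Then $\mu(t)$ is finite and $S_t$ is integrable with $E[S_t]=\mu(t)$ for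 all $t\ge0$ (so the policy with threshold $\mu$ is optimal), $\mu$ is differentiable on $(0,\infty)$, and, as $t\to\infty$, $$\mu(t)\sim\frac1c\ln t,\qquad \mu'(t)\sim\frac{1}{ct},$$ where $\sim$ means that the ratio tends to $1$. If moreover $E[X_0^2]<\infty$, then $E[S_t^2]<\infty$ for all $t\ge 0$ and $$\lim_{t\to\infty}\operatorname{Var}[S_t]=\frac{2}{c^2}.$$ -/

import Mathlib

open MeasureTheory ProbabilityTheory Filter Topology

/-- Time remaining when the `n`-th offer arrives: `t₀ = t` and `tₙ₊₁ = (tₙ - Dₙ₊₁)₊`, where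
`d n` is the waiting time `Dₙ₊₁` before the `(n+1)`-st offer. -/
def timeLeft (t : ℝ) (d : ℕ → ℝ) : ℕ → ℝ
  | 0 => t
  | n + 1 => max (timeLeft t d n - d n) 0

/-- A policy is a set `A` of pairs (time remaining, offer): an offer `x` that arrives when the
time remaining is `s` is accepted iff `(s, x) ∈ A`. `Accepts A t d x n` says that the
`(n+1)`-st offer `x n` arrives before the deadline and is acceptable to the policy `A`. -/
def Accepts (A : Set (ℝ × ℝ)) (t : ℝ) (d x : ℕ → ℝ) (n : ℕ) : Prop :=
  0 < timeLeft t d (n + 1) ∧ (timeLeft t d (n + 1), x n) ∈ A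

open Classical in
/-- Realized sale price when the policy `A` is followed from the moment when the time to the
deadline is `t`: the first acceptable offer that arrives before the deadline, and the residual
price `x₀` if there is none. -/
noncomputable def salePrice (A : Set (ℝ × ℝ)) (t : ℝ) (d x : ℕ → ℝ) (x₀ : ℝ) : ℝ :=
  if h : ∃ n, Accepts A t d x n then x (Nat.find h) else x₀

/-- The random data of the bidding process: iid exponential waiting times `D` of rate `r`
(so that offers arrive as a Poisson process), iid offers `X` with law `ν`, and a residual price
`X₀` with law `ν₀`, all of them mutually independent. -/
structure IsBiddingProcess {Ω : Type*} [MeasurableSpace Ω] (P : Measure Ω) (r : ℝ)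
    (ν ν₀ : Measure ℝ) (D X : ℕ → Ω → ℝ) (X₀ : Ω → ℝ) : Prop where
  measurable_wait : ∀ n, Measurable (D n)
  measurable_offer : ∀ n, Measurable (X n)
  measurable_residual : Measurable X₀
  law_wait : ∀ n, P.map (D n) = expMeasure r
  law_offer : ∀ n, P.map (X n) = ν
  law_residual : P.map X₀ = ν₀
  indep : iIndepFun (Sum.elim D (Sum.elim X (fun _ : Unit => X₀))) P

/-- Random sale price under the policy `A`, with time `t` to the deadline. -/
noncomputable def randomSalePrice {Ω : Type*} (D X : ℕ → Ω → ℝ) (X₀ : Ω → ℝ)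
    (A : Set (ℝ × ℝ)) (t : ℝ) (ω : Ω) : ℝ :=
  salePrice A t (fun n => D n ω) (fun n => X n ω) (X₀ ω)

/-- The expected sale prices that (measurable) policies achieve, with time `t` to the deadline. -/
def expectedPrices {Ω : Type*} [MeasurableSpace Ω] (P : Measure Ω) (D X : ℕ → Ω → ℝ)
    (X₀ : Ω → ℝ) (t : ℝ) : Set ℝ :=
  {v | ∃ A : Set (ℝ × ℝ), MeasurableSet A ∧ Integrable (randomSalePrice D X X₀ A t) P ∧
    v = ∫ ω, randomSalePrice D X X₀ A t ω ∂P}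

/-- `μ(t)`: the maximal expected sale price when the time to the deadline is `t`. It is what the
seller can expect after rejecting an offer at that time, hence the optimal threshold. -/
noncomputable def optimalThreshold {Ω : Type*} [MeasurableSpace Ω] (P : Measure Ω)
    (D X : ℕ → Ω → ℝ) (X₀ : Ω → ℝ) (t : ℝ) : ℝ :=
  sSup (expectedPrices P D X X₀ t)

/-- The policy that accepts an offer `x` at time `s` to the deadline iff `x ≥ m s`. -/
def thresholdPolicy (m : ℝ → ℝ) : Set (ℝ × ℝ) := {p | m p.1 ≤ p.2}

/-- `S_t`: the sale price under the optimal policy, with time `t` to the deadline. -/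
noncomputable def optimalSalePrice {Ω : Type*} [MeasurableSpace Ω] (P : Measure Ω)
    (D X : ℕ → Ω → ℝ) (X₀ : Ω → ℝ) (t : ℝ) : Ω → ℝ :=
  randomSalePrice D X X₀ (thresholdPolicy (optimalThreshold P D X X₀)) t

/-- `M`: the supremum, in the extended reals, of the points where the distribution function of
the offers is less than `1`. -/
noncomputable def offerSup (ν : Measure ℝ) : EReal :=
  sSup ((fun x : ℝ => (x : EReal)) '' {x : ℝ | cdf ν x < 1})

/-- `φ(x) = ∫ₓ^∞ (1 - F(u)) du`. -/
noncomputable def tailIntegral (ν : Measure ℝ) (x : ℝ) : ℝ :=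
  ∫ u in Set.Ioi x, (1 - cdf ν u)

/-!
Let `r` be the rate of the offers, `φ = tailIntegral ν` and `Φ(x) = ∫ₓ^∞ φ`. Layer-cake formulas
give `φ(x) = E[(X₁ - x)₊]` and `2 Φ(x) = E[((X₁ - x)₊)²]`.

*Optimality.* Let `m` solve `m' = r φ(m)`, `m(0) = E[X₀]` (`exists_threshold`). An offer that
arrives when the time to the deadline is `u` is worth at most `max(X₁, m(u))`, whose mean is
`m(u) + φ(m(u)) = m(u) + m'(u) / r`; averaging this over the exponential waiting time gives back
`m` (`integral_expMeasure_eq_of_hasDerivWithinAt`). So, for every policy, the process that equals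
the sale price once the asset is sold and `m` of the remaining time before that is a
supermartingale, and it is a martingale for the policy with threshold `m`. The lemmas
`IsSupersolution.integral_reward_le` and `IsSupersolution.integral_reward_eq` carry this out for a
general reward function of the price; hence `m` is the optimal threshold.

*Second moment.* The same lemmas with the reward `x²` show that the variance of the optimal price
is the solution of `σ²' = r (2 Φ(m) - P(X₁ ≥ m) σ²)`. Since the left derivative of `φ` at `x` is
`-P(X₁ ≥ x)`, the function `1 / φ(m)` is an integrating factor:
`σ²(t) = φ(m(t)) (σ²(0) / φ(m(0)) + r ∫₀ᵗ 2 Φ(m) / φ(m))` (`varianceSolution`). The law of the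
offers may have atoms, so these are one-sided derivatives, which is all that the fundamental
theorem of calculus needs.

*Asymptotics.* The only tool is that `f' → L` implies `f(t) / t → L`
(`tendsto_div_self_of_hasDerivAt`). The derivative of `1 / Φ(m(t))` is `r (φ / Φ)² → r c²`, so
`t φ(m(t)) → 1 / (r c)`, which is `m'(t) ∼ 1 / (c t)`. Applied to `u ↦ m(eᵘ)` the tool gives
`m(t) ∼ (1 / c) log t`, and applied to the second factor of `σ²` it gives `2 r / c` for the limit of
that factor divided by `t`, so that `σ² → 2 / c²`.
-/

/-! ### The tail integral of the offers -/

section TailIntegral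

lemma tailIntegral_nonneg (ν : Measure ℝ) (x : ℝ) : 0 ≤ tailIntegral ν x :=
  integral_nonneg fun u => sub_nonneg.2 (cdf_le_one ν u)

variable {ν : Measure ℝ} [IsProbabilityMeasure ν]

lemma integrable_posPart_sub (hν : Integrable (fun x : ℝ => max x 0) ν) (x : ℝ) :
    Integrable (fun y : ℝ => max (y - x) 0) ν := by
  refine (hν.add (integrable_const |x|)).mono' (by fun_prop) (ae_of_all _ fun y => ?_)
  rw [Real.norm_of_nonneg (le_max_right _ _)]
  have := neg_abs_le x
  exact max_le (by simp only [Pi.add_apply]; linarith [le_max_left y 0])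
    (by simp only [Pi.add_apply]; linarith [le_max_right y 0, abs_nonneg x])

lemma tailIntegral_eq_integral_posPart (hν : Integrable (fun x : ℝ => max x 0) ν) (x : ℝ) :
    tailIntegral ν x = ∫ y, max (y - x) 0 ∂ν := by
  rw [(integrable_posPart_sub hν x).integral_eq_integral_meas_lt
    (ae_of_all _ fun y => le_max_right _ _), tailIntegral]
  have h := (measurePreserving_add_right volume x).setIntegral_preimage_emb
    (measurableEmbedding_addRight x) (fun u => 1 - cdf ν u) (Set.Ioi x)
  rw [← h]
  have h2 : (fun y => y + x) ⁻¹' Set.Ioi x = Set.Ioi 0 := by ext y; simp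
  rw [h2]
  refine setIntegral_congr_fun measurableSet_Ioi fun t ht => ?_
  have h3 : {a : ℝ | t < max (a - x) 0} = (Set.Iic (t + x))ᶜ := by
    ext a
    simp only [Set.mem_ofPred_eq, lt_max_iff, Set.mem_compl_iff, Set.mem_Iic, not_le]
    constructor
    · rintro (h | h)
      · linarith
      · exact absurd h (not_lt.2 (le_of_lt ht))
    · intro h; left; linarith
  simp only [h3]
  rw [probReal_compl_eq_one_sub measurableSet_Iic, cdf_eq_real]

lemma abs_tailIntegral_sub_le (hν : Integrable (fun x : ℝ => max x 0) ν) (x z : ℝ) :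
    |tailIntegral ν x - tailIntegral ν z| ≤ |x - z| := by
  rw [tailIntegral_eq_integral_posPart hν, tailIntegral_eq_integral_posPart hν,
    ← integral_sub (integrable_posPart_sub hν x) (integrable_posPart_sub hν z), ← Real.norm_eq_abs]
  refine (norm_integral_le_of_norm_le_const (C := |x - z|) (ae_of_all _ fun y => ?_)).trans
    (by simp)
  refine (abs_max_sub_max_le_abs _ _ _).trans ?_
  rw [show y - x - (y - z) = -(x - z) by ring, abs_neg]

lemma continuous_tailIntegral (hν : Integrable (fun x : ℝ => max x 0) ν) :
    Continuous (tailIntegral ν) :=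
  (LipschitzWith.of_dist_le_mul (K := 1) fun x z => by
    simpa [Real.dist_eq] using abs_tailIntegral_sub_le hν x z).continuous

lemma antitone_tailIntegral (hν : Integrable (fun x : ℝ => max x 0) ν) :
    Antitone (tailIntegral ν) := by
  intro x z hxz
  rw [tailIntegral_eq_integral_posPart hν, tailIntegral_eq_integral_posPart hν]
  exact integral_mono (integrable_posPart_sub hν z) (integrable_posPart_sub hν x)
    fun y => max_le_max (by linarith) le_rfl

lemma tailIntegral_pos (hν : Integrable (fun x : ℝ => max x 0) ν) (hM : offerSup ν = ⊤) (x : ℝ) :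
    0 < tailIntegral ν x := by
  rw [tailIntegral_eq_integral_posPart hν]
  refine (integral_pos_iff_support_of_nonneg (fun y => le_max_right (y - x) 0)
    (integrable_posPart_sub hν x)).2 ?_
  have h1 : (x : EReal) < offerSup ν := hM ▸ EReal.coe_lt_top x
  obtain ⟨_, ⟨z, hz, rfl⟩, hxz⟩ := lt_sSup_iff.1 h1
  have hxz' : x < z := EReal.coe_lt_coe_iff.1 hxz
  have h2 : (Set.Iic z)ᶜ ⊆ Function.support fun y : ℝ => max (y - x) 0 := by
    intro y hy
    simp only [Set.mem_compl_iff, Set.mem_Iic, not_le] at hy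
    exact (lt_max_of_lt_left (by linarith)).ne'
  refine lt_of_lt_of_le ?_ (measure_mono h2)
  rw [pos_iff_ne_zero]
  intro h0
  have h3 : ν.real (Set.Iic z)ᶜ = 0 := by rw [measureReal_def, h0]; simp
  rw [probReal_compl_eq_one_sub measurableSet_Iic, ← cdf_eq_real] at h3
  have : cdf ν z < 1 := hz
  linarith

/-- The tail integral need not be differentiable, but its left derivative at `x` is minus the
probability that an offer is at least `x`. -/
lemma hasDerivWithinAt_tailIntegral_left (hν : Integrable (fun x : ℝ => max x 0) ν) (x : ℝ) :
    HasDerivWithinAt (tailIntegral ν) (-ν.real (Set.Ici x)) (Set.Iio x) x := by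
  rw [hasDerivWithinAt_iff_tendsto_slope' (by simp)]
  have h1 : ∀ z, slope (tailIntegral ν) x z
      = ∫ y, (z - x)⁻¹ * (max (y - z) 0 - max (y - x) 0) ∂ν := fun z => by
    rw [integral_const_mul, integral_sub (integrable_posPart_sub hν z)
      (integrable_posPart_sub hν x), slope_def_field, tailIntegral_eq_integral_posPart hν,
      tailIntegral_eq_integral_posPart hν]
    ring
  have h2 : -ν.real (Set.Ici x) = ∫ y, (Set.Ici x).indicator (fun _ => (-1 : ℝ)) y ∂ν := by
    rw [integral_indicator measurableSet_Ici]; simp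
  rw [h2]
  refine Tendsto.congr (fun z => (h1 z).symm) ?_
  refine tendsto_integral_filter_of_dominated_convergence (fun _ => 1)
    (Eventually.of_forall fun z => by fun_prop) ?_ (integrable_const 1) ?_
  · filter_upwards [self_mem_nhdsWithin] with z hz
    refine ae_of_all _ fun y => ?_
    have hz' : (z : ℝ) < x := hz
    rw [norm_mul, norm_inv, Real.norm_eq_abs, Real.norm_eq_abs]
    have h3 := abs_max_sub_max_le_abs (y - z) (y - x) 0
    rw [show y - z - (y - x) = -(z - x) by ring, abs_neg] at h3
    rw [inv_mul_le_iff₀ (abs_pos.2 (by linarith))]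
    linarith
  · refine ae_of_all _ fun y => ?_
    by_cases hy : x ≤ y
    · rw [Set.indicator_of_mem (Set.mem_Ici.2 hy)]
      refine tendsto_const_nhds.congr' ?_
      filter_upwards [self_mem_nhdsWithin] with z hz
      have hz' : z < x := hz
      rw [max_eq_left (by linarith), max_eq_left (by linarith)]
      have : z - x ≠ 0 := by linarith
      field_simp
      ring
    · rw [Set.indicator_of_notMem (by simpa using hy)]
      refine tendsto_const_nhds.congr' ?_
      push Not at hy
      filter_upwards [Ioo_mem_nhdsLT hy] with z hz
      rw [max_eq_right (by linarith [hz.1]), max_eq_right (by linarith)]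
      simp

lemma lintegral_Ioi_posPart_sub (x y : ℝ) :
    ∫⁻ u in Set.Ioi x, ENNReal.ofReal (max (y - u) 0) = ENNReal.ofReal ((max (y - x) 0) ^ 2 / 2) := by
  have h0 : ∫⁻ u in Set.Ioi x, ENNReal.ofReal (max (y - u) 0)
      = ∫⁻ u in Set.Ioc x (max x y), ENNReal.ofReal (max (y - u) 0) := by
    rw [← Set.Ioc_union_Ioi_eq_Ioi (le_max_left x y), lintegral_union measurableSet_Ioi
      (Set.Ioc_disjoint_Ioi le_rfl)]
    conv_rhs => rw [← add_zero (∫⁻ u in Set.Ioc x (max x y), ENNReal.ofReal (max (y - u) 0))]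
    congr 1
    rw [setLIntegral_congr_fun measurableSet_Ioi (g := fun _ => 0)]
    · simp
    · intro u hu
      have : y < u := (le_max_right x y).trans_lt hu
      simp [this.le]
  rw [h0, ← ofReal_integral_eq_lintegral_ofReal
    ((by fun_prop : Continuous fun u : ℝ => max (y - u) 0).integrableOn_Ioc)
    (ae_of_all _ fun u => le_max_right _ _), ← intervalIntegral.integral_of_le (le_max_left _ _)]
  congr 1
  rcases le_total x y with h | h
  · rw [max_eq_right h, max_eq_left (by linarith)]
    have : ∫ u in x..y, max (y - u) 0 = ∫ u in x..y, (y - u) :=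
      intervalIntegral.integral_congr fun u hu => by
        rw [Set.uIcc_of_le h] at hu
        exact max_eq_left (by linarith [hu.2])
    rw [this, intervalIntegral.integral_comp_sub_left (fun u => u)]
    simp
  · rw [max_eq_left h, max_eq_right (by linarith)]
    simp

lemma lintegral_tailIntegral (hν : Integrable (fun x : ℝ => max x 0) ν) (x : ℝ) :
    ∫⁻ u in Set.Ioi x, ENNReal.ofReal (tailIntegral ν u)
      = ∫⁻ y, ENNReal.ofReal ((max (y - x) 0) ^ 2 / 2) ∂ν := by
  have h1 : ∀ u, ENNReal.ofReal (tailIntegral ν u) = ∫⁻ y, ENNReal.ofReal (max (y - u) 0) ∂ν :=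
    fun u => by
      rw [tailIntegral_eq_integral_posPart hν, ofReal_integral_eq_lintegral_ofReal
        (integrable_posPart_sub hν u) (ae_of_all _ fun y => le_max_right _ _)]
  simp_rw [h1]
  rw [lintegral_lintegral_swap (by fun_prop)]
  simp_rw [lintegral_Ioi_posPart_sub]

lemma integrable_sq_posPart_sub (hν : Integrable (fun x : ℝ => max x 0) ν) {x : ℝ}
    (hx : IntegrableOn (tailIntegral ν) (Set.Ioi x)) :
    Integrable (fun y : ℝ => (max (y - x) 0) ^ 2) ν := by
  have h1 : Integrable (fun y : ℝ => (max (y - x) 0) ^ 2 / 2) ν := by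
    refine ⟨by fun_prop, ?_⟩
    rw [hasFiniteIntegral_iff_ofReal (ae_of_all _ fun y => by positivity),
      ← lintegral_tailIntegral hν]
    exact hx.lintegral_lt_top
  simpa using h1.mul_const 2

lemma integral_sq_posPart_sub (hν : Integrable (fun x : ℝ => max x 0) ν) (x : ℝ) :
    ∫ y, (max (y - x) 0) ^ 2 ∂ν = 2 * ∫ u in Set.Ioi x, tailIntegral ν u := by
  have h1 : ∫ y, (max (y - x) 0) ^ 2 / 2 ∂ν = ∫ u in Set.Ioi x, tailIntegral ν u := by
    rw [integral_eq_lintegral_of_nonneg_ae (ae_of_all _ fun y => by positivity) (by fun_prop),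
      ← lintegral_tailIntegral hν, integral_eq_lintegral_of_nonneg_ae
      (ae_of_all _ fun y => tailIntegral_nonneg ν y) (continuous_tailIntegral hν).aestronglyMeasurable]
  rw [← h1, integral_div]
  ring

/-- A nonzero limit of `φ(x) / ∫ₓ^∞ φ` forces `φ` to be integrable at `+∞`: otherwise the
denominator is the junk value `0`. -/
lemma integrableOn_tailIntegral (hν : Integrable (fun x : ℝ => max x 0) ν) {c : ℝ} (hc : 0 < c)
    (htail : Tendsto (fun x : ℝ => tailIntegral ν x / ∫ u in Set.Ioi x, tailIntegral ν u)
      atTop (𝓝 c)) (x : ℝ) : IntegrableOn (tailIntegral ν) (Set.Ioi x) := by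
  obtain ⟨z, hz, hxz⟩ := ((htail.eventually (lt_mem_nhds hc)).and (eventually_ge_atTop x)).exists
  have h1 : IntegrableOn (tailIntegral ν) (Set.Ioi z) := by
    by_contra h
    rw [integral_undef h] at hz
    simp at hz
  rw [← Set.Ioc_union_Ioi_eq_Ioi hxz]
  exact (continuous_tailIntegral hν).integrableOn_Ioc.union h1

lemma hasDerivAt_integral_tailIntegral (hν : Integrable (fun x : ℝ => max x 0) ν)
    (hint : ∀ x, IntegrableOn (tailIntegral ν) (Set.Ioi x)) (x : ℝ) :
    HasDerivAt (fun x => ∫ u in Set.Ioi x, tailIntegral ν u) (-tailIntegral ν x) x := by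
  have h1 : (fun z => ∫ u in Set.Ioi z, tailIntegral ν u)
      = fun z => (∫ u in Set.Ioi x, tailIntegral ν u) - ∫ u in x..z, tailIntegral ν u := by
    funext z
    rw [← intervalIntegral.integral_Ioi_sub_Ioi' (hint x) (hint z)]
    ring
  rw [h1]
  have hc := continuous_tailIntegral hν
  exact (intervalIntegral.integral_hasDerivAt_right (hc.intervalIntegrable _ _)
    hc.stronglyMeasurable.stronglyMeasurableAtFilter hc.continuousAt).const_sub _

lemma integral_tailIntegral_pos (hν : Integrable (fun x : ℝ => max x 0) ν)
    (hM : offerSup ν = ⊤) (hint : ∀ x, IntegrableOn (tailIntegral ν) (Set.Ioi x)) (x : ℝ) :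
    0 < ∫ u in Set.Ioi x, tailIntegral ν u := by
  rw [setIntegral_pos_iff_support_of_nonneg_ae (ae_of_all _ fun y => tailIntegral_nonneg ν y) (hint x)]
  have : Function.support (tailIntegral ν) = Set.univ :=
    Set.eq_univ_of_forall fun y => (tailIntegral_pos hν hM y).ne'
  simp [this]

end TailIntegral

/-! ### The threshold equation and its asymptotics -/

section Threshold

/-- A mean-value form of L'Hôpital's rule: a function whose derivative tends to `L` grows
like `L * t`. -/
lemma tendsto_div_self_of_hasDerivAt {f f' : ℝ → ℝ} {L : ℝ}
    (hf : ∀ᶠ t in atTop, HasDerivAt f (f' t) t) (hf' : Tendsto f' atTop (𝓝 L)) :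
    Tendsto (fun t => f t / t) atTop (𝓝 L) := by
  rw [Metric.tendsto_atTop]
  intro ε hε
  have hev : ∀ᶠ t in atTop, HasDerivAt f (f' t) t ∧ dist (f' t) L < ε / 2 :=
    hf.and (hf'.eventually (Metric.ball_mem_nhds L (half_pos hε)))
  obtain ⟨T, hT⟩ := eventually_atTop.1 hev
  have hb : ∀ t ≥ T, |f t - f T - L * (t - T)| ≤ ε / 2 * (t - T) := fun t ht => by
    have h := (convex_Ici T).norm_image_sub_le_of_norm_hasDerivWithin_le
      (f := fun s => f s - L * s) (f' := fun s => f' s - L) (C := ε / 2) (x := T) (y := t)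
      (fun s hs => ((hT s hs).1.sub (by simpa using (hasDerivAt_id s).const_mul L)).hasDerivWithinAt)
      (fun s hs => by simpa [Real.dist_eq] using (hT s hs).2.le) (Set.mem_Ici.2 le_rfl)
      (Set.mem_Ici.2 ht)
    rw [Real.norm_eq_abs, Real.norm_eq_abs, abs_of_nonneg (sub_nonneg.2 ht)] at h
    convert h using 2
    ring
  have hlim : Tendsto (fun t : ℝ => (|f T - L * T| + ε / 2 * |T|) / t) atTop (𝓝 0) :=
    tendsto_const_nhds.div_atTop tendsto_id
  obtain ⟨T', hT'⟩ := eventually_atTop.1 (hlim.eventually (gt_mem_nhds (half_pos hε)))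
  refine ⟨max (max T T') 1, fun t ht => ?_⟩
  have h1 : T ≤ t := (le_max_left _ _).trans ((le_max_left _ _).trans ht)
  have h2 : T' ≤ t := (le_max_right _ _).trans ((le_max_left _ _).trans ht)
  have h3 : 0 < t := zero_lt_one.trans_le ((le_max_right _ _).trans ht)
  have h4 := hT' t h2
  rw [div_lt_iff₀ h3] at h4
  rw [Real.dist_eq, show f t / t - L = (f t - L * t) / t by field_simp, abs_div, abs_of_pos h3,
    div_lt_iff₀ h3]
  have h5 := hb t h1
  have h6 : |f t - L * t| ≤ |f t - f T - L * (t - T)| + |f T - L * T| := by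
    refine le_trans (le_of_eq ?_) (abs_add_le _ _)
    ring_nf
  have h7 : -|T| ≤ T := neg_abs_le T
  nlinarith

/-- The autonomous equation `m' = r φ(m)`, `m 0 = a`, is solved on `[0, ∞)` by inverting
`x ↦ ∫ₐˣ du / (r φ(u))`. -/
lemma exists_threshold {φ : ℝ → ℝ} (hcont : Continuous φ) (hpos : ∀ x, 0 < φ x)
    (hanti : Antitone φ) (a : ℝ) {r : ℝ} (hr : 0 < r) :
    ∃ m : ℝ → ℝ, StrictMono m ∧ Continuous m ∧ m 0 = a ∧ Tendsto m atTop atTop ∧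
      ∀ t, 0 ≤ t → HasDerivAt m (r * φ (m t)) t := by
  -- Capping `φ` at `φ a` changes nothing to the right of `a` and makes the primitive surjective.
  set g : ℝ → ℝ := fun u => (r * min (φ u) (φ a))⁻¹ with hg
  have hgpos : ∀ u, 0 < r * min (φ u) (φ a) := fun u => mul_pos hr (lt_min (hpos u) (hpos a))
  have hgc : Continuous g :=
    (continuous_const.mul (hcont.min continuous_const)).inv₀ fun u => (hgpos u).ne'
  have hgi : ∀ x y, IntervalIntegrable g volume x y := hgc.intervalIntegrable
  set k : ℝ := (r * φ a)⁻¹ with hk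
  have hkpos : 0 < k := inv_pos.2 (mul_pos hr (hpos a))
  have hgk : ∀ u, k ≤ g u := fun u =>
    inv_anti₀ (hgpos u) (mul_le_mul_of_nonneg_left (min_le_right _ _) hr.le)
  set G : ℝ → ℝ := fun x => ∫ u in a..x, g u with hG
  have hGd : ∀ x, HasDerivAt G (g x) x := fun x =>
    intervalIntegral.integral_hasDerivAt_right (hgc.intervalIntegrable _ _)
      hgc.stronglyMeasurable.stronglyMeasurableAtFilter hgc.continuousAt
  have hGc : Continuous G := continuous_iff_continuousAt.2 fun x => (hGd x).continuousAt
  have hGinc : ∀ x y, x ≤ y → k * (y - x) ≤ G y - G x := fun x y hxy => by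
    have h := intervalIntegral.integral_interval_sub_left (hgi a y) (hgi a x)
    have h' := intervalIntegral.integral_mono_on hxy intervalIntegrable_const (hgi x y)
      (fun u _ => hgk u)
    rw [intervalIntegral.integral_const, smul_eq_mul, mul_comm] at h'
    exact h'.trans_eq h.symm
  have hGmono : StrictMono G := fun x y hxy => by
    have := hGinc x y hxy.le
    nlinarith [mul_pos hkpos (sub_pos.2 hxy)]
  have hGa : G a = 0 := by simp [hG]
  have htop : Tendsto G atTop atTop := by
    refine tendsto_atTop_mono' _ ?_ ((tendsto_atTop_add_const_right _ (-a) tendsto_id).const_mul_atTop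
      hkpos)
    filter_upwards [eventually_ge_atTop a] with x hx
    have := hGinc a x hx
    rw [hGa, sub_zero] at this
    simpa [sub_eq_add_neg] using this
  have hbot : Tendsto G atBot atBot := by
    refine tendsto_atBot_mono' _ ?_ ((tendsto_atBot_add_const_right _ (-a) tendsto_id).const_mul_atBot
      hkpos)
    filter_upwards [eventually_le_atBot a] with x hx
    have := hGinc x a hx
    rw [hGa] at this
    simp only [id]
    linarith
  set e := hGmono.orderIsoOfSurjective G (hGc.surjective htop hbot) with he
  have hGe : ∀ t, G (e.symm t) = t := fun t => e.apply_symm_apply t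
  have heG : ∀ x, e.symm (G x) = x := fun x => e.symm_apply_apply x
  have h0 : e.symm 0 = a := by rw [← hGa]; exact heG a
  refine ⟨e.symm, e.symm.strictMono, e.symm.continuous, h0, e.symm.tendsto_atTop, fun t ht => ?_⟩
  have h1 := HasDerivAt.of_local_left_inverse e.symm.continuous.continuousAt (hGd (e.symm t))
    (hkpos.trans_le (hgk _)).ne' (Eventually.of_forall hGe)
  have h2 : a ≤ e.symm t := h0 ▸ e.symm.monotone ht
  have h3 : (g (e.symm t))⁻¹ = r * φ (e.symm t) := by
    simp only [hg, inv_inv]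
    rw [min_eq_left (hanti h2)]
  exact h3 ▸ h1

variable {φ Φ m : ℝ → ℝ} {r c : ℝ}

/-- Along a solution of `m' = r φ(m)` the function `1 / Φ(m t)` has derivative
`r (φ / Φ)² → r c²`. -/
lemma tendsto_mul_tail_threshold (hr : 0 < r) (hc : 0 < c) (hΦpos : ∀ x, 0 < Φ x)
    (hΦ : ∀ x, HasDerivAt Φ (-φ x) x) (hlim : Tendsto (fun x => φ x / Φ x) atTop (𝓝 c))
    (hm : ∀ t, 0 ≤ t → HasDerivAt m (r * φ (m t)) t) (htop : Tendsto m atTop atTop) :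
    Tendsto (fun t => t * φ (m t)) atTop (𝓝 (1 / (r * c))) := by
  have h1 : Tendsto (fun t => (Φ (m t))⁻¹ / t) atTop (𝓝 (r * c ^ 2)) := by
    refine tendsto_div_self_of_hasDerivAt (f' := fun t => r * (φ (m t) / Φ (m t)) ^ 2) ?_
      (((hlim.comp htop).pow 2).const_mul r)
    filter_upwards [eventually_ge_atTop 0] with t ht
    have := (((hΦ (m t)).comp t (hm t ht)).inv (hΦpos _).ne')
    refine this.congr_deriv ?_
    have := (hΦpos (m t)).ne'
    simp only [Function.comp]
    field_simp
  have h2 := (hlim.comp htop).mul (h1.inv₀ (by positivity))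
  rw [show c * (r * c ^ 2)⁻¹ = 1 / (r * c) by field_simp] at h2
  refine h2.congr fun t => ?_
  have := (hΦpos (m t)).ne'
  simp only [Function.comp]
  field_simp

lemma isEquivalent_deriv_threshold (hr : 0 < r) (hc : 0 < c)
    (hlim : Tendsto (fun t => t * φ (m t)) atTop (𝓝 (1 / (r * c)))) :
    Asymptotics.IsEquivalent atTop (fun t => r * φ (m t)) (fun t : ℝ => 1 / (c * t)) := by
  refine Asymptotics.isEquivalent_of_tendsto_one ?_
  have h := hlim.const_mul (r * c)
  rw [show r * c * (1 / (r * c)) = 1 by field_simp] at h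
  refine h.congr fun t => ?_
  simp only [Pi.div_apply]
  rw [div_div_eq_mul_div, div_one]
  ring

/-- The substitution `t = eᵘ` turns `m(t) ∼ (1/c) log t` into linear growth in `u`. -/
lemma isEquivalent_threshold (hr : 0 < r) (hc : 0 < c)
    (hlim : Tendsto (fun t => t * φ (m t)) atTop (𝓝 (1 / (r * c))))
    (hm : ∀ t, 0 ≤ t → HasDerivAt m (r * φ (m t)) t) :
    Asymptotics.IsEquivalent atTop m (fun t : ℝ => 1 / c * Real.log t) := by
  have h1 : Tendsto (fun u => m (Real.exp u) / u) atTop (𝓝 (1 / c)) := by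
    refine tendsto_div_self_of_hasDerivAt
      (f' := fun u => r * (Real.exp u * φ (m (Real.exp u)))) ?_ ?_
    · refine Eventually.of_forall fun u => ?_
      have := (hm _ (Real.exp_pos u).le).comp u (Real.hasDerivAt_exp u)
      exact this.congr_deriv (by ring)
    · have := (hlim.comp Real.tendsto_exp_atTop).const_mul r
      rwa [show r * (1 / (r * c)) = 1 / c by field_simp] at this
  refine Asymptotics.isEquivalent_of_tendsto_one ?_
  have h2 := (h1.comp Real.tendsto_log_atTop).const_mul c
  rw [show c * (1 / c) = 1 by field_simp] at h2
  refine h2.congr' ?_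
  filter_upwards [eventually_gt_atTop 0] with t ht
  simp only [Function.comp, Pi.div_apply, Real.exp_log ht]
  field_simp

/-- The solution of the variance equation `σ²' = r (2 Φ(m) - P(X ≥ m) σ²)` with initial value `s`,
obtained by variation of constants with the integrating factor `1 / φ(m)`. -/
noncomputable def varianceSolution (φ Φ m : ℝ → ℝ) (r s t : ℝ) : ℝ :=
  φ (m t) * (s / φ (m 0) + ∫ u in (0 : ℝ)..t, r * (2 * Φ (m u) / φ (m u)))

lemma tendsto_varianceSolution (hr : 0 < r) (hc : 0 < c) (s : ℝ)
    (hφ : Continuous φ) (hφpos : ∀ x, 0 < φ x) (hΦ : Continuous Φ) (hmc : Continuous m)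
    (hlim : Tendsto (fun x => φ x / Φ x) atTop (𝓝 c)) (htop : Tendsto m atTop atTop)
    (hlim' : Tendsto (fun t => t * φ (m t)) atTop (𝓝 (1 / (r * c)))) :
    Tendsto (varianceSolution φ Φ m r s) atTop (𝓝 (2 / c ^ 2)) := by
  have hcont : Continuous fun u => r * (2 * Φ (m u) / φ (m u)) :=
    continuous_const.mul ((continuous_const.mul (hΦ.comp hmc)).div (hφ.comp hmc)
      fun u => (hφpos _).ne')
  have h1 : Tendsto (fun t => (s / φ (m 0) + ∫ u in (0 : ℝ)..t, r * (2 * Φ (m u) / φ (m u))) / t)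
      atTop (𝓝 (r * (2 * c⁻¹))) := by
    refine tendsto_div_self_of_hasDerivAt (f' := fun u => r * (2 * Φ (m u) / φ (m u)))
      (Eventually.of_forall fun t => ?_) ?_
    · exact (intervalIntegral.integral_hasDerivAt_right (hcont.intervalIntegrable _ _)
        hcont.stronglyMeasurable.stronglyMeasurableAtFilter hcont.continuousAt).const_add _
    · refine ((((hlim.comp htop).inv₀ hc.ne').const_mul 2).const_mul r).congr fun t => ?_
      simp only [Function.comp, inv_div]
      ring
  have h2 := hlim'.mul h1
  rw [show 1 / (r * c) * (r * (2 * c⁻¹)) = 2 / c ^ 2 by field_simp] at h2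
  refine h2.congr' ?_
  filter_upwards [eventually_gt_atTop 0] with t ht
  rw [varianceSolution]
  field_simp

lemma continuous_varianceSolution (s : ℝ)
    (hφ : Continuous φ) (hφpos : ∀ x, 0 < φ x) (hΦ : Continuous Φ) (hmc : Continuous m) :
    Continuous (varianceSolution φ Φ m r s) := by
  have hcont : Continuous fun u => r * (2 * Φ (m u) / φ (m u)) :=
    continuous_const.mul ((continuous_const.mul (hΦ.comp hmc)).div (hφ.comp hmc)
      fun u => (hφpos _).ne')
  exact (hφ.comp hmc).mul (continuous_const.add
    (intervalIntegral.continuous_primitive (fun a b => hcont.intervalIntegrable a b) 0))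

lemma varianceSolution_zero (hφpos : ∀ x, 0 < φ x) (s : ℝ) :
    varianceSolution φ Φ m r s 0 = s := by
  have := (hφpos (m 0)).ne'
  simp only [varianceSolution, intervalIntegral.integral_same, add_zero]
  field_simp

lemma varianceSolution_nonneg (hr : 0 < r) {s t : ℝ} (hs : 0 ≤ s) (ht : 0 ≤ t)
    (hφpos : ∀ x, 0 < φ x) (hΦpos : ∀ x, 0 < Φ x) : 0 ≤ varianceSolution φ Φ m r s t := by
  refine mul_nonneg (hφpos _).le (add_nonneg (div_nonneg hs (hφpos _).le)
    (intervalIntegral.integral_nonneg ht fun u _ => ?_))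
  have h1 := hφpos (m u)
  have h2 := hΦpos (m u)
  positivity

lemma hasDerivWithinAt_varianceSolution {p : ℝ → ℝ} (s : ℝ) {t : ℝ} (ht : 0 ≤ t)
    (hφ : Continuous φ) (hφpos : ∀ x, 0 < φ x) (hΦ : Continuous Φ) (hmc : Continuous m)
    (hmono : StrictMono m) (hm : ∀ t, 0 ≤ t → HasDerivAt m (r * φ (m t)) t)
    (hφ' : ∀ x, HasDerivWithinAt φ (-p x) (Set.Iio x) x) :
    HasDerivWithinAt (varianceSolution φ Φ m r s)
      (r * (2 * Φ (m t) - p (m t) * varianceSolution φ Φ m r s t)) (Set.Iio t) t := by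
  have hcont : Continuous fun u => r * (2 * Φ (m u) / φ (m u)) :=
    continuous_const.mul ((continuous_const.mul (hΦ.comp hmc)).div (hφ.comp hmc)
      fun u => (hφpos _).ne')
  have h1 : HasDerivAt (fun t => s / φ (m 0) + ∫ u in (0 : ℝ)..t, r * (2 * Φ (m u) / φ (m u)))
      (r * (2 * Φ (m t) / φ (m t))) t :=
    (intervalIntegral.integral_hasDerivAt_right (hcont.intervalIntegrable _ _)
        hcont.stronglyMeasurable.stronglyMeasurableAtFilter hcont.continuousAt).const_add _
  have h2 : HasDerivWithinAt (fun t => φ (m t)) (-p (m t) * (r * φ (m t))) (Set.Iio t) t :=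
    (hφ' (m t)).comp t (hm t ht).hasDerivWithinAt fun u hu => hmono hu
  have h3 := h2.mul h1.hasDerivWithinAt
  refine h3.congr_deriv ?_
  have := (hφpos (m t)).ne'
  simp only [varianceSolution]
  field_simp
  ring

end Threshold

/-! ### One step of the bidding process -/

section OneStep

variable {r : ℝ}

lemma expMeasure_eq_withDensity (r : ℝ) :
    expMeasure r = volume.withDensity (exponentialPDF r) := rfl

lemma measurable_exponentialPDF (r : ℝ) : Measurable (exponentialPDF r) :=
  (measurable_exponentialPDFReal r).ennreal_ofReal

lemma ae_pos_expMeasure (r : ℝ) : ∀ᵐ d ∂expMeasure r, 0 < d := by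
  rw [expMeasure_eq_withDensity, ae_withDensity_iff (measurable_exponentialPDF r)]
  have h0 : ∀ᵐ d : ℝ, d ≠ 0 := by simp [ae_iff]
  filter_upwards [h0] with d hd hpdf
  by_contra h
  exact hpdf (exponentialPDF_of_neg (lt_of_le_of_ne (not_lt.1 h) hd))

lemma integral_expMeasure (hr : 0 < r) (g : ℝ → ℝ) :
    ∫ d, g d ∂expMeasure r = ∫ d in Set.Ioi 0, r * Real.exp (-(r * d)) * g d := by
  rw [expMeasure_eq_withDensity, integral_withDensity_eq_integral_toReal_smul
    (measurable_exponentialPDF r) (ae_of_all _ fun _ => ENNReal.ofReal_lt_top),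
    ← integral_indicator measurableSet_Ioi]
  have h0 : ∀ᵐ d : ℝ, d ≠ 0 := by simp [ae_iff]
  refine integral_congr_ae ?_
  filter_upwards [h0] with d hd
  rcases lt_or_gt_of_ne hd with h | h
  · rw [exponentialPDF_of_neg h, Set.indicator_of_notMem (by simpa using h.le)]
    simp
  · rw [exponentialPDF_of_nonneg h.le, Set.indicator_of_mem (Set.mem_Ioi.2 h),
      ENNReal.toReal_ofReal (by positivity), smul_eq_mul]

lemma integrableOn_exp_neg_mul (hr : 0 < r) (a : ℝ) :
    IntegrableOn (fun d => r * Real.exp (-(r * d))) (Set.Ioi a) := by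
  have := (exp_neg_integrableOn_Ioi a hr).const_mul r
  simpa [neg_mul, IntegrableOn] using this

lemma integral_Ioi_exp_neg_mul (hr : 0 < r) (a : ℝ) :
    ∫ d in Set.Ioi a, r * Real.exp (-(r * d)) = Real.exp (-(r * a)) := by
  have h : Tendsto (fun d => -Real.exp (-(r * d))) atTop (𝓝 0) := by
    have := (Real.tendsto_exp_neg_atTop_nhds_zero.comp (tendsto_id.const_mul_atTop hr)).neg
    simpa [Function.comp_def] using this
  have := integral_Ioi_of_hasDerivAt_of_tendsto' (a := a) (fun x _ => hasDerivAt_neg_exp_mul_exp)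
    (integrableOn_exp_neg_mul hr a) h
  rw [this]
  ring

/-- Exponential smoothing over the time that the next offer takes to arrive: if
`w' = r (e - w)` from the left, then `w s` is the mean of `e` at the time of the next offer, with
`w 0` in its place when no offer arrives before the deadline. One-sided derivatives suffice,
which is what allows atoms in the law of the offers. -/
lemma integral_expMeasure_eq_of_hasDerivWithinAt (hr : 0 < r) {w e : ℝ → ℝ} (hw : Continuous w)
    (he : Measurable e) {s C : ℝ} (hs : 0 ≤ s) (hC : ∀ u, 0 < u → u ≤ s → |e u| ≤ C)
    (hw' : ∀ u, 0 < u → u ≤ s → HasDerivWithinAt w (r * (e u - w u)) (Set.Iio u) u) :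
    ∫ d, (if 0 < s - d then e (s - d) else w 0) ∂expMeasure r = w s := by
  set g : ℝ → ℝ := fun d => if 0 < s - d then e (s - d) else w 0 with hg
  have hgm : Measurable g :=
    Measurable.ite (measurableSet_lt measurable_const (by fun_prop))
      (he.comp (by fun_prop)) measurable_const
  have hgb : ∀ d, 0 < d → |g d| ≤ max C |w 0| := fun d hd => by
    simp only [hg]
    split_ifs with h
    · exact (hC _ h (by linarith)).trans (le_max_left _ _)
    · exact le_max_right _ _
  have hint : IntegrableOn (fun d => r * Real.exp (-(r * d)) * g d) (Set.Ioi 0) := by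
    refine (integrableOn_exp_neg_mul hr 0).mul_bdd (c := max C |w 0|) hgm.aestronglyMeasurable ?_
    filter_upwards [ae_restrict_mem measurableSet_Ioi] with d hd
    exact hgb d hd
  rw [integral_expMeasure hr, ← Set.Ioc_union_Ioi_eq_Ioi hs,
    setIntegral_union (Set.Ioc_disjoint_Ioi le_rfl) measurableSet_Ioi
      (hint.mono_set Set.Ioc_subset_Ioi_self) (hint.mono_set (Set.Ioi_subset_Ioi hs))]
  have h1 : ∫ d in Set.Ioi s, r * Real.exp (-(r * d)) * g d = Real.exp (-(r * s)) * w 0 := by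
    rw [← integral_Ioi_exp_neg_mul hr s, ← integral_mul_const]
    refine setIntegral_congr_fun measurableSet_Ioi fun d hd => ?_
    have : ¬ (0 < s - d) := by
      have : s < d := hd
      linarith
    simp only [hg, if_neg this]
  have h2 : ∫ d in Set.Ioc 0 s, r * Real.exp (-(r * d)) * g d = w s - Real.exp (-(r * s)) * w 0 := by
    rw [← intervalIntegral.integral_of_le hs]
    have h3 := intervalIntegral.integral_eq_sub_of_hasDeriv_right
      (f := fun d => -Real.exp (-(r * d)) * w (s - d))
      (f' := fun d => r * Real.exp (-(r * d)) * g d) (a := 0) (b := s)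
      (by fun_prop) ?_ ?_
    · rw [h3]
      simp
      ring
    · intro d hd
      rw [min_eq_left hs, max_eq_right hs] at hd
      have h4 : HasDerivWithinAt (fun d => w (s - d)) (r * (e (s - d) - w (s - d)) * (-1))
          (Set.Ioi d) d :=
        (hw' (s - d) (by linarith [hd.2]) (by linarith [hd.1])).comp d
          ((hasDerivAt_id d).const_sub s).hasDerivWithinAt fun z hz => by
            have : d < z := hz
            show s - z < s - d
            linarith
      have h5 := (hasDerivAt_neg_exp_mul_exp (r := r) (x := d)).hasDerivWithinAt.mul h4
      refine h5.congr_deriv ?_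
      simp only [hg, if_pos (sub_pos.2 hd.2)]
      ring
    · rw [intervalIntegrable_iff_integrableOn_Ioc_of_le hs]
      exact hint.mono_set Set.Ioc_subset_Ioi_self
  rw [h1, h2]
  ring

/-- Value of one step of the bidding process from time `s` to the deadline: an offer `x` that
arrives after the waiting time `d` is worth `b u x` at the new time `u = s - d`, and the
terminal value `w 0` is due if the deadline comes first. -/
noncomputable def stepValue (w : ℝ → ℝ) (b : ℝ → ℝ → ℝ) (s d x : ℝ) : ℝ :=
  if 0 < s - d then b (s - d) x else w 0

lemma measurable_stepValue {w : ℝ → ℝ} {b : ℝ → ℝ → ℝ} (hb : Measurable (Function.uncurry b)) :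
    Measurable fun q : ℝ × ℝ × ℝ => stepValue w b q.1 q.2.1 q.2.2 :=
  Measurable.ite (measurableSet_lt measurable_const (by fun_prop))
    (hb.comp (f := fun q : ℝ × ℝ × ℝ => (q.1 - q.2.1, q.2.2)) (by fun_prop)) measurable_const

lemma abs_stepValue_le {w k : ℝ → ℝ} {b : ℝ → ℝ → ℝ} {t s d x : ℝ} (hst : s ≤ t) (hd : 0 < d)
    (hk : ∀ u, 0 < u → u ≤ t → ∀ x, |b u x| ≤ k x) :
    |stepValue w b s d x| ≤ |w 0| + |k x| := by
  rw [stepValue]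
  split_ifs with h
  · have := hk _ h (by linarith) x
    linarith [le_abs_self (k x), abs_nonneg (w 0)]
  · linarith [abs_nonneg (k x)]

lemma integrable_stepValue (hr : 0 < r) {ν : Measure ℝ} [IsProbabilityMeasure ν] {w k : ℝ → ℝ}
    {b : ℝ → ℝ → ℝ} (hb : Measurable (Function.uncurry b)) {t s : ℝ}
    (hk : ∀ u, 0 < u → u ≤ t → ∀ x, |b u x| ≤ k x) (hkint : Integrable k ν) (hst : s ≤ t) :
    Integrable (fun q : ℝ × ℝ => stepValue w b s q.1 q.2) ((expMeasure r).prod ν) := by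
  have := isProbabilityMeasure_expMeasure hr
  have hm : Measurable fun q : ℝ × ℝ => stepValue w b s q.1 q.2 :=
    (measurable_stepValue hb).comp (f := fun q : ℝ × ℝ => (s, q)) (by fun_prop)
  refine ((integrable_const |w 0|).add (hkint.abs.comp_snd (expMeasure r))).mono'
    hm.aestronglyMeasurable ?_
  have h0 : ∀ᵐ q : ℝ × ℝ ∂(expMeasure r).prod ν, 0 < q.1 :=
    Measure.quasiMeasurePreserving_fst.ae (ae_pos_expMeasure r)
  filter_upwards [h0] with q hq
  exact abs_stepValue_le hst hq hk

lemma integral_stepValue (hr : 0 < r) {ν : Measure ℝ} [IsProbabilityMeasure ν] {w k : ℝ → ℝ}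
    {b : ℝ → ℝ → ℝ} (hw : Continuous w) (hb : Measurable (Function.uncurry b)) {t s : ℝ}
    (hk : ∀ u, 0 < u → u ≤ t → ∀ x, |b u x| ≤ k x) (hkint : Integrable k ν)
    (hw' : ∀ u, 0 < u → u ≤ t →
      HasDerivWithinAt w (r * (∫ x, b u x ∂ν - w u)) (Set.Iio u) u) (hs : 0 ≤ s) (hst : s ≤ t) :
    ∫ q, stepValue w b s q.1 q.2 ∂(expMeasure r).prod ν = w s := by
  have := isProbabilityMeasure_expMeasure hr
  rw [integral_prod _ (integrable_stepValue hr hb hk hkint hst)]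
  have he : Measurable fun u => ∫ x, b u x ∂ν :=
    (hb.stronglyMeasurable.integral_prod_right (ν := ν)).measurable
  rw [← integral_expMeasure_eq_of_hasDerivWithinAt hr hw he hs (C := ∫ x, k x ∂ν) ?_
    fun u h0 h1 => hw' u h0 (h1.trans hst)]
  · refine integral_congr_ae (ae_of_all _ fun d => ?_)
    simp only [stepValue]
    split_ifs <;> simp
  · intro u h0 h1
    rw [← Real.norm_eq_abs]
    exact norm_integral_le_of_norm_le hkint (ae_of_all _ fun x => hk u h0 (h1.trans hst) x)

end OneStep

/-! ### The bidding process up to the `n`-th offer -/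

section Bidding

/-- Random time to the deadline when the `n`-th offer arrives. -/
def remainingTime {Ω : Type*} (D : ℕ → Ω → ℝ) (t : ℝ) (n : ℕ) (ω : Ω) : ℝ :=
  timeLeft t (fun k => D k ω) n

/-- The event that the policy `A` accepts none of the first `n` offers. -/
def unsold {Ω : Type*} (D X : ℕ → Ω → ℝ) (A : Set (ℝ × ℝ)) (t : ℝ) (n : ℕ) : Set Ω :=
  {ω | ∀ k < n, ¬ Accepts A t (fun k => D k ω) (fun k => X k ω) k}

variable {Ω : Type*} {D X : ℕ → Ω → ℝ} {X₀ : Ω → ℝ} {A : Set (ℝ × ℝ)} {t : ℝ}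

lemma remainingTime_succ (n : ℕ) (ω : Ω) :
    remainingTime D t (n + 1) ω = max (remainingTime D t n ω - D n ω) 0 := rfl

lemma remainingTime_nonneg (ht : 0 ≤ t) (n : ℕ) (ω : Ω) : 0 ≤ remainingTime D t n ω := by
  cases n with
  | zero => exact ht
  | succ n => exact le_max_right _ _

lemma remainingTime_le (ht : 0 ≤ t) {ω : Ω} (hω : ∀ n, 0 < D n ω) (n : ℕ) :
    remainingTime D t n ω ≤ t := by
  induction n with
  | zero => exact le_rfl
  | succ n ih =>
    rw [remainingTime_succ]
    exact max_le (by linarith [hω n]) ht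

lemma remainingTime_eq_zero_of_le (ht : 0 ≤ t) {ω : Ω} (hω : ∀ n, 0 < D n ω) {n : ℕ}
    (hn : t ≤ D n ω) {k : ℕ} (hk : n + 1 ≤ k) : remainingTime D t k ω = 0 := by
  induction k, hk using Nat.le_induction with
  | base =>
    rw [remainingTime_succ]
    exact max_eq_right (by linarith [remainingTime_le ht hω n])
  | succ k _ ih =>
    rw [remainingTime_succ, ih]
    exact max_eq_right (by linarith [hω k])

lemma mem_unsold_zero (ω : Ω) : ω ∈ unsold D X A t 0 := fun _ hk => absurd hk (Nat.not_lt_zero _)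

lemma mem_unsold_succ {n : ℕ} {ω : Ω} : ω ∈ unsold D X A t (n + 1) ↔
    ω ∈ unsold D X A t n ∧ ¬ Accepts A t (fun k => D k ω) (fun k => X k ω) n := by
  constructor
  · exact fun h => ⟨fun k hk => h k (hk.trans n.lt_succ_self), h n n.lt_succ_self⟩
  · rintro ⟨h1, h2⟩ k hk
    rcases Nat.lt_succ_iff_lt_or_eq.1 hk with h | rfl
    · exact h1 k h
    · exact h2

lemma unsold_antitone : Antitone (unsold D X A t) :=
  fun _ _ hnk _ h k hk => h k (hk.trans_le hnk)

lemma randomSalePrice_of_accepts {n : ℕ} {ω : Ω} (h1 : ω ∈ unsold D X A t n)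
    (h2 : Accepts A t (fun k => D k ω) (fun k => X k ω) n) :
    randomSalePrice D X X₀ A t ω = X n ω := by
  classical
  have h : ∃ n, Accepts A t (fun k => D k ω) (fun k => X k ω) n := ⟨n, h2⟩
  rw [randomSalePrice, salePrice, dif_pos h, (Nat.find_eq_iff h).2 ⟨h2, h1⟩]

lemma randomSalePrice_of_forall_unsold {ω : Ω} (h : ∀ n, ω ∈ unsold D X A t n) :
    randomSalePrice D X X₀ A t ω = X₀ ω := by
  classical
  rw [randomSalePrice, salePrice, dif_neg]
  rintro ⟨n, hn⟩
  exact h (n + 1) n n.lt_succ_self hn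

lemma measurable_remainingTime {mΩ : MeasurableSpace Ω} {n : ℕ}
    (hD : ∀ k < n, Measurable (D k)) : Measurable (remainingTime D t n) := by
  induction n with
  | zero => exact measurable_const
  | succ n ih =>
    have h1 := ih fun k hk => hD k (hk.trans n.lt_succ_self)
    exact (h1.sub (hD n n.lt_succ_self)).max measurable_const

lemma measurableSet_accepts {mΩ : MeasurableSpace Ω} (hA : MeasurableSet A) {n : ℕ}
    (hD : ∀ k ≤ n, Measurable (D k)) (hX : Measurable (X n)) :
    MeasurableSet {ω | Accepts A t (fun k => D k ω) (fun k => X k ω) n} := by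
  have h1 : Measurable (remainingTime D t (n + 1)) :=
    measurable_remainingTime fun k hk => hD k (Nat.lt_succ_iff.1 hk)
  exact (measurableSet_lt measurable_const h1).inter ((h1.prodMk hX) hA)

lemma measurableSet_unsold {mΩ : MeasurableSpace Ω} (hA : MeasurableSet A) {n : ℕ}
    (hD : ∀ k < n, Measurable (D k)) (hX : ∀ k < n, Measurable (X k)) :
    MeasurableSet (unsold D X A t n) := by
  induction n with
  | zero =>
    convert MeasurableSet.univ
    exact Set.eq_univ_of_forall mem_unsold_zero
  | succ n ih =>
    have h1 := ih (fun k hk => hD k (hk.trans n.lt_succ_self))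
      (fun k hk => hX k (hk.trans n.lt_succ_self))
    have h2 := measurableSet_accepts (t := t) hA (fun k hk => hD k (Nat.lt_succ_iff.2 hk))
      (hX n n.lt_succ_self)
    convert h1.inter h2.compl
    ext ω
    exact mem_unsold_succ

open Classical in
/-- The value of the sale after `n` offers: the reward `h` of the price obtained if the asset is
sold, and otherwise the continuation value `w` at the remaining time. -/
noncomputable def interimValue (h w : ℝ → ℝ) (D X : ℕ → Ω → ℝ) (X₀ : Ω → ℝ) (A : Set (ℝ × ℝ))
    (t : ℝ) (n : ℕ) (ω : Ω) : ℝ :=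
  if ω ∈ unsold D X A t n then w (remainingTime D t n ω) else h (randomSalePrice D X X₀ A t ω)

open Classical in
/-- The limit of `interimValue`: an asset that is never sold is credited with `w 0`. -/
noncomputable def finalValue (h w : ℝ → ℝ) (D X : ℕ → Ω → ℝ) (X₀ : Ω → ℝ) (A : Set (ℝ × ℝ))
    (t : ℝ) (ω : Ω) : ℝ :=
  if ω ∈ ⋂ n, unsold D X A t n then w 0 else h (randomSalePrice D X X₀ A t ω)

variable {h w : ℝ → ℝ}

lemma interimValue_zero (ω : Ω) : interimValue h w D X X₀ A t 0 ω = w t :=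
  if_pos (mem_unsold_zero ω)

open Classical in
lemma interimValue_succ (n : ℕ) (ω : Ω) : interimValue h w D X X₀ A t (n + 1) ω =
    if ω ∈ unsold D X A t n then
      (if Accepts A t (fun k => D k ω) (fun k => X k ω) n then h (X n ω)
        else w (remainingTime D t (n + 1) ω))
    else interimValue h w D X X₀ A t n ω := by
  by_cases h1 : ω ∈ unsold D X A t n
  · by_cases h2 : Accepts A t (fun k => D k ω) (fun k => X k ω) n
    · rw [interimValue, if_neg (fun h3 => (mem_unsold_succ.1 h3).2 h2), if_pos h1, if_pos h2,
        randomSalePrice_of_accepts h1 h2]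
    · rw [interimValue, if_pos (mem_unsold_succ.2 ⟨h1, h2⟩), if_pos h1, if_neg h2]
  · rw [interimValue, if_neg (fun h3 => h1 (mem_unsold_succ.1 h3).1), if_neg h1, interimValue,
      if_neg h1]

lemma measurable_interimValue {mΩ : MeasurableSpace Ω} (hA : MeasurableSet A)
    (hD : ∀ n, Measurable (D n)) (hX : ∀ n, Measurable (X n)) (hh : Measurable h)
    (hw : Measurable w) (n : ℕ) : Measurable (interimValue h w D X X₀ A t n) := by
  classical
  induction n with
  | zero =>
    have : interimValue h w D X X₀ A t 0 = fun _ => w t := funext interimValue_zero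
    rw [this]
    exact measurable_const
  | succ n ih =>
    have h1 := measurableSet_unsold (n := n) (t := t) hA (fun k _ => hD k) (fun k _ => hX k)
    have h2 := measurableSet_accepts (n := n) (t := t) hA (fun k _ => hD k) (hX n)
    have h3 : Measurable (remainingTime D t (n + 1)) := measurable_remainingTime fun k _ => hD k
    have : interimValue h w D X X₀ A t (n + 1) = fun ω => _ := funext (interimValue_succ n)
    rw [this]
    exact Measurable.ite h1 (Measurable.ite h2 (hh.comp (hX n)) (hw.comp h3)) ih

lemma measurableSet_iInter_unsold {mΩ : MeasurableSpace Ω} (hA : MeasurableSet A)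
    (hD : ∀ n, Measurable (D n)) (hX : ∀ n, Measurable (X n)) :
    MeasurableSet (⋂ n, unsold D X A t n) :=
  MeasurableSet.iInter fun _ => measurableSet_unsold hA (fun k _ => hD k) (fun k _ => hX k)

/-- The reward of the sale price differs from `finalValue` only on the event that the asset is
never sold. -/
lemma reward_eq_finalValue_add (ω : Ω) : h (randomSalePrice D X X₀ A t ω) =
    finalValue h w D X X₀ A t ω +
      (⋂ n, unsold D X A t n).indicator (fun _ => 1) ω * (h (X₀ ω) - w 0) := by
  by_cases h1 : ω ∈ ⋂ n, unsold D X A t n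
  · rw [finalValue, if_pos h1, Set.indicator_of_mem h1,
      randomSalePrice_of_forall_unsold (Set.mem_iInter.1 h1)]
    ring
  · rw [finalValue, if_neg h1, Set.indicator_of_notMem h1]
    ring

lemma eventually_interimValue_eq (ht : 0 ≤ t) {ω : Ω} (hω : ∀ n, 0 < D n ω)
    (hω' : ∃ n, t ≤ D n ω) :
    ∀ᶠ n in atTop, interimValue h w D X X₀ A t n ω = finalValue h w D X X₀ A t ω := by
  by_cases h1 : ω ∈ ⋂ n, unsold D X A t n
  · obtain ⟨n, hn⟩ := hω'
    filter_upwards [eventually_ge_atTop (n + 1)] with k hk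
    rw [interimValue, if_pos (Set.mem_iInter.1 h1 k), finalValue, if_pos h1,
      remainingTime_eq_zero_of_le ht hω hn hk]
  · have h2 : ∃ n, ω ∉ unsold D X A t n := by simpa using h1
    obtain ⟨n, hn⟩ := h2
    filter_upwards [eventually_ge_atTop n] with k hk
    rw [interimValue, if_neg fun h3 => hn (unsold_antitone hk h3), finalValue, if_neg h1]

end Bidding

/-! ### Independence -/

/-- The σ-algebra generated by the waiting times, offers and residual price whose indices lie
in `S`. -/
abbrev bidSigma {Ω : Type*} (D X : ℕ → Ω → ℝ) (X₀ : Ω → ℝ) (S : Set (ℕ ⊕ ℕ ⊕ Unit)) :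
    MeasurableSpace Ω :=
  ⨆ i ∈ S, MeasurableSpace.comap (Sum.elim D (Sum.elim X (fun _ : Unit => X₀)) i) inferInstance

lemma measurable_bidSigma {Ω : Type*} {D X : ℕ → Ω → ℝ} {X₀ : Ω → ℝ} {S : Set (ℕ ⊕ ℕ ⊕ Unit)}
    {i : ℕ ⊕ ℕ ⊕ Unit} (hi : i ∈ S) :
    Measurable[bidSigma D X X₀ S] (Sum.elim D (Sum.elim X (fun _ : Unit => X₀)) i) :=
  measurable_iff_comap_le.2 (le_iSup₂_of_le i hi le_rfl)

namespace IsBiddingProcess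

variable {Ω : Type*} [MeasurableSpace Ω] {P : Measure Ω} {r : ℝ}
  {ν ν₀ : Measure ℝ} {D X : ℕ → Ω → ℝ} {X₀ : Ω → ℝ}

/-- Functions of disjoint families of the waiting times, offers and residual price are
independent. -/
lemma indepFun_of_disjoint (hp : IsBiddingProcess P r ν ν₀ D X X₀) {β γ : Type*}
    {mβ : MeasurableSpace β} {mγ : MeasurableSpace γ} {S T : Set (ℕ ⊕ ℕ ⊕ Unit)}
    (hST : Disjoint S T) {f : Ω → β} {g : Ω → γ} (hf : Measurable[bidSigma D X X₀ S] f)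
    (hg : Measurable[bidSigma D X X₀ T] g) : IndepFun f g P := by
  rw [IndepFun_iff_Indep]
  refine indep_of_indep_of_le (indep_iSup_of_disjoint ?_ hp.indep.iIndep hST)
    hf.comap_le hg.comap_le
  rintro (n | n | n)
  · exact (hp.measurable_wait n).comap_le
  · exact (hp.measurable_offer n).comap_le
  · exact hp.measurable_residual.comap_le

/-- The remaining time at the `n`-th offer and the event that the first `n` offers are rejected
depend on the first `n` waiting times and offers only. -/
lemma indepFun_past (hp : IsBiddingProcess P r ν ν₀ D X X₀) {A : Set (ℝ × ℝ)}
    (hA : MeasurableSet A) (t : ℝ) (n : ℕ) :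
    IndepFun (fun ω => (remainingTime D t n ω, (unsold D X A t n).indicator (fun _ => (1 : ℝ)) ω))
      (fun ω => (D n ω, X n ω)) P := by
  set S : Set (ℕ ⊕ ℕ ⊕ Unit) := {i | (∃ k < n, i = Sum.inl k) ∨ ∃ k < n, i = Sum.inr (Sum.inl k)}
    with hS
  set T : Set (ℕ ⊕ ℕ ⊕ Unit) := {i | i = Sum.inl n ∨ i = Sum.inr (Sum.inl n)} with hT
  have hST : Disjoint S T := by
    rw [Set.disjoint_left]
    rintro i (⟨k, hk, rfl⟩ | ⟨k, hk, rfl⟩) (h | h) <;> simp at h <;> omega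
  have hD : ∀ k < n, Measurable[bidSigma D X X₀ S] (D k) := fun k hk =>
    measurable_bidSigma (i := Sum.inl k) (Or.inl ⟨k, hk, rfl⟩)
  have hX : ∀ k < n, Measurable[bidSigma D X X₀ S] (X k) := fun k hk =>
    measurable_bidSigma (i := Sum.inr (Sum.inl k)) (Or.inr ⟨k, hk, rfl⟩)
  have hDn : Measurable[bidSigma D X X₀ T] (D n) :=
    measurable_bidSigma (i := Sum.inl n) (Or.inl rfl)
  have hXn : Measurable[bidSigma D X X₀ T] (X n) :=
    measurable_bidSigma (i := Sum.inr (Sum.inl n)) (Or.inr rfl)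
  exact hp.indepFun_of_disjoint hST ((measurable_remainingTime hD).prodMk
    (measurable_const.indicator (measurableSet_unsold hA hD hX))) (hDn.prodMk hXn)

lemma indepFun_offer (hp : IsBiddingProcess P r ν ν₀ D X X₀) (n : ℕ) :
    IndepFun (D n) (X n) P :=
  hp.indep.indepFun (i := Sum.inl n) (j := Sum.inr (Sum.inl n)) (by simp)

lemma map_offer [IsProbabilityMeasure P] (hp : IsBiddingProcess P r ν ν₀ D X X₀) (n : ℕ) :
    P.map (fun ω => (D n ω, X n ω)) = (expMeasure r).prod ν := by
  rw [(indepFun_iff_map_prod_eq_prod_map_map (hp.measurable_wait n).aemeasurable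
    (hp.measurable_offer n).aemeasurable).1 (hp.indepFun_offer n), hp.law_wait, hp.law_offer]

lemma indepFun_residual (hp : IsBiddingProcess P r ν ν₀ D X X₀) {A : Set (ℝ × ℝ)}
    (hA : MeasurableSet A) (t : ℝ) :
    IndepFun ((⋂ n, unsold D X A t n).indicator (fun _ => (1 : ℝ))) X₀ P := by
  set S : Set (ℕ ⊕ ℕ ⊕ Unit) := {i | i ≠ Sum.inr (Sum.inr ())} with hS
  set T : Set (ℕ ⊕ ℕ ⊕ Unit) := {Sum.inr (Sum.inr ())} with hT
  have hST : Disjoint S T := by simp [hS, hT]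
  have hD : ∀ k, Measurable[bidSigma D X X₀ S] (D k) := fun k =>
    measurable_bidSigma (i := Sum.inl k) (by simp [hS])
  have hX : ∀ k, Measurable[bidSigma D X X₀ S] (X k) := fun k =>
    measurable_bidSigma (i := Sum.inr (Sum.inl k)) (by simp [hS])
  have hX₀ : Measurable[bidSigma D X X₀ T] X₀ :=
    measurable_bidSigma (i := Sum.inr (Sum.inr ())) rfl
  exact hp.indepFun_of_disjoint hST
    (measurable_const.indicator (measurableSet_iInter_unsold hA hD hX)) hX₀

lemma ae_wait_pos (hp : IsBiddingProcess P r ν ν₀ D X X₀) : ∀ᵐ ω ∂P, ∀ n, 0 < D n ω := by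
  rw [ae_all_iff]
  intro n
  have := ae_pos_expMeasure r
  rw [← hp.law_wait n] at this
  exact ae_of_ae_map (hp.measurable_wait n).aemeasurable this

/-- By the second Borel–Cantelli lemma some waiting time exceeds the time to the deadline, so only
finitely many offers arrive. -/
lemma ae_exists_le_wait [IsProbabilityMeasure P] (hp : IsBiddingProcess P r ν ν₀ D X X₀) (hr : 0 < r) (t : ℝ) :
    ∀ᵐ ω ∂P, ∃ n, t ≤ D n ω := by
  have := isProbabilityMeasure_expMeasure hr
  set E : ℕ → Set Ω := fun n => D n ⁻¹' Set.Ioi t with hE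
  have hEm : ∀ n, MeasurableSet (E n) := fun n => hp.measurable_wait n measurableSet_Ioi
  have hEP : ∀ n, P (E n) = expMeasure r (Set.Ioi t) := fun n => by
    rw [← hp.law_wait n, Measure.map_apply (hp.measurable_wait n) measurableSet_Ioi]
  have hpos : expMeasure r (Set.Ioi t) ≠ 0 := by
    intro h0
    have h1 : (expMeasure r).real (Set.Iic t)ᶜ = 0 := by
      rw [measureReal_def, Set.compl_Iic, h0]; simp
    rw [probReal_compl_eq_one_sub measurableSet_Iic, ← cdf_eq_real, cdf_expMeasure_eq hr] at h1
    split_ifs at h1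
    · have := Real.exp_pos (-(r * t))
      linarith
    · norm_num at h1
  have hind : iIndepSet E P := by
    rw [iIndepSet_iff_meas_biInter hEm]
    intro s
    have h1 : iIndepFun D P := hp.indep.precomp (g := Sum.inl) Sum.inl_injective
    exact h1.meas_biInter fun i _ => ⟨Set.Ioi t, measurableSet_Ioi, rfl⟩
  have h1 := measure_limsup_eq_one hEm hind (by
    simp_rw [hEP]
    exact ENNReal.tsum_const_eq_top_of_ne_zero hpos)
  have h2 : ∀ᵐ ω ∂P, ω ∈ limsup E atTop :=
    (mem_ae_iff_prob_eq_one (MeasurableSet.measurableSet_limsup hEm)).2 h1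
  filter_upwards [h2] with ω hω
  rw [mem_limsup_iff_frequently_mem] at hω
  obtain ⟨n, hn⟩ := hω.exists
  exact ⟨n, le_of_lt hn⟩

end IsBiddingProcess

/-! ### Verification: supersolutions bound the expected reward -/

section Verification

/-- `w` is a supersolution, up to time `t`, for the reward `h` of the sale price under the policy
`A`. An offer `x` at time `u` to the deadline yields `h x` if it is accepted and the continuation
value `w u` otherwise; this is at most `b u x`, and `w' = r (E[b u X₁] - w)` for the left derivative
of `w`. The function `k` dominates `b u` for all `u` at once, so that expectations exist. -/
structure IsSupersolution (r : ℝ) (ν : Measure ℝ) (A : Set (ℝ × ℝ)) (t : ℝ) (h w : ℝ → ℝ)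
    (b : ℝ → ℝ → ℝ) (k : ℝ → ℝ) : Prop where
  measurable_reward : Measurable h
  continuous_value : Continuous w
  measurable_bound : Measurable (Function.uncurry b)
  integrable_dom : Integrable k ν
  abs_le : ∀ u, 0 < u → u ≤ t → ∀ x, |b u x| ≤ k x
  hasDeriv : ∀ u, 0 < u → u ≤ t → HasDerivWithinAt w (r * (∫ x, b u x ∂ν - w u)) (Set.Iio u) u
  reward_le : ∀ u, 0 < u → u ≤ t → ∀ x, (u, x) ∈ A → h x ≤ b u x
  value_le : ∀ u, 0 < u → u ≤ t → ∀ x, (u, x) ∉ A → w u ≤ b u x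

variable {Ω : Type*} {mΩ : MeasurableSpace Ω} {P : Measure Ω} {r : ℝ}
  {ν ν₀ : Measure ℝ} {D X : ℕ → Ω → ℝ} {X₀ : Ω → ℝ} {A : Set (ℝ × ℝ)}
  {t : ℝ} {h w : ℝ → ℝ} {b : ℝ → ℝ → ℝ} {k : ℝ → ℝ}

namespace IsBiddingProcess

lemma integrable_comp_offer (hp : IsBiddingProcess P r ν ν₀ D X X₀) (hk : Integrable k ν) (n : ℕ) :
    Integrable (fun ω => k (X n ω)) P := by
  rw [← hp.law_offer n] at hk
  exact hk.comp_measurable (hp.measurable_offer n)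

lemma integrable_comp_residual (hp : IsBiddingProcess P r ν ν₀ D X X₀) (hh : Integrable h ν₀) :
    Integrable (fun ω => h (X₀ ω)) P := by
  rw [← hp.law_residual] at hh
  exact hh.comp_measurable hp.measurable_residual

lemma integrable_unsold_mul_residual [IsProbabilityMeasure P]
    (hp : IsBiddingProcess P r ν ν₀ D X X₀) (hA : MeasurableSet A) (h₀ : Integrable h ν₀) :
    Integrable (fun ω => (⋂ n, unsold D X A t n).indicator (fun _ => (1 : ℝ)) ω *
      (h (X₀ ω) - w 0)) P := by
  have h1 := hp.integrable_comp_residual h₀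
  have hm : Measurable ((⋂ n, unsold D X A t n).indicator (fun _ => (1 : ℝ))) :=
    measurable_const.indicator
      (measurableSet_iInter_unsold hA hp.measurable_wait hp.measurable_offer)
  refine (h1.sub (integrable_const (w 0))).bdd_mul (c := 1) hm.aestronglyMeasurable
    (ae_of_all _ fun ω => ?_)
  by_cases h4 : ω ∈ ⋂ n, unsold D X A t n
  · rw [Set.indicator_of_mem h4]; simp
  · rw [Set.indicator_of_notMem h4]; simp

lemma integral_unsold_mul_residual [IsProbabilityMeasure P]
    (hp : IsBiddingProcess P r ν ν₀ D X X₀) (hA : MeasurableSet A) (hh : Measurable h) (h₀ : Integrable h ν₀)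
    (hw₀ : w 0 = ∫ x, h x ∂ν₀) :
    ∫ ω, (⋂ n, unsold D X A t n).indicator (fun _ => (1 : ℝ)) ω * (h (X₀ ω) - w 0) ∂P = 0 := by
  have h1 := hp.integrable_comp_residual h₀
  have hm : Measurable ((⋂ n, unsold D X A t n).indicator (fun _ => (1 : ℝ))) :=
    measurable_const.indicator
      (measurableSet_iInter_unsold hA hp.measurable_wait hp.measurable_offer)
  have hg : Measurable fun x => h x - w 0 := hh.sub_const _
  have h2 := ((hp.indepFun_residual hA t).comp measurable_id hg).integral_mul_eq_mul_integral
    hm.aestronglyMeasurable (hg.comp hp.measurable_residual).aestronglyMeasurable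
  have h3 : ∫ ω, h (X₀ ω) ∂P = w 0 := by
    rw [hw₀, ← hp.law_residual, integral_map hp.measurable_residual.aemeasurable
      hh.aestronglyMeasurable]
  have h4 : ∫ ω, ((fun x => h x - w 0) ∘ X₀) ω ∂P = 0 := by
    simp only [Function.comp]
    rw [integral_sub h1 (integrable_const _), h3]
    simp
  rw [h4, mul_zero] at h2
  exact h2

lemma tendsto_interimValue [IsProbabilityMeasure P] (hp : IsBiddingProcess P r ν ν₀ D X X₀) (hr : 0 < r) (ht : 0 ≤ t) :
    ∀ᵐ ω ∂P, Tendsto (fun n => interimValue h w D X X₀ A t n ω) atTop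
      (𝓝 (finalValue h w D X X₀ A t ω)) := by
  filter_upwards [hp.ae_wait_pos, hp.ae_exists_le_wait hr t] with ω h1 h2
  exact tendsto_const_nhds.congr' ((eventually_interimValue_eq ht h1 h2).mono fun n hn => hn.symm)

end IsBiddingProcess

namespace IsSupersolution

lemma interimValue_succ_le (hs : IsSupersolution r ν A t h w b k) (ht : 0 ≤ t) {ω : Ω}
    (hω : ∀ n, 0 < D n ω) (n : ℕ) :
    interimValue h w D X X₀ A t (n + 1) ω ≤ interimValue h w D X X₀ A t n ω +
      (unsold D X A t n).indicator (fun _ => (1 : ℝ)) ω *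
        (stepValue w b (remainingTime D t n ω) (D n ω) (X n ω) - w (remainingTime D t n ω)) := by
  classical
  rw [interimValue_succ]
  by_cases h1 : ω ∈ unsold D X A t n
  · rw [if_pos h1, Set.indicator_of_mem h1, interimValue, if_pos h1]
    have hle := remainingTime_le ht hω n
    have hd := hω n
    have hτ := remainingTime_succ (D := D) (t := t) n ω
    have key : (if Accepts A t (fun k => D k ω) (fun k => X k ω) n then h (X n ω)
        else w (remainingTime D t (n + 1) ω))
        ≤ stepValue w b (remainingTime D t n ω) (D n ω) (X n ω) := by
      rw [stepValue]
      split_ifs with h2 h3 h3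
      · have h4 : (remainingTime D t (n + 1) ω, X n ω) ∈ A := h2.2
        rw [hτ, max_eq_left h3.le] at h4
        exact hs.reward_le _ h3 (by linarith) _ h4
      · have h4 : 0 < remainingTime D t (n + 1) ω := h2.1
        rw [hτ, max_eq_right (not_lt.1 h3)] at h4
        exact absurd h4 (lt_irrefl 0)
      · rw [hτ, max_eq_left h3.le]
        refine hs.value_le _ h3 (by linarith) _ fun h4 => h2 ⟨?_, ?_⟩
        · change 0 < remainingTime D t (n + 1) ω
          rwa [hτ, max_eq_left h3.le]
        · change (remainingTime D t (n + 1) ω, X n ω) ∈ A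
          rwa [hτ, max_eq_left h3.le]
      · rw [hτ, max_eq_right (not_lt.1 h3)]
    linarith
  · rw [if_neg h1, Set.indicator_of_notMem h1]
    simp

lemma exists_abs_value_le (hs : IsSupersolution r ν A t h w b k) :
    ∃ C, 0 ≤ C ∧ ∀ u, 0 ≤ u → u ≤ t → |w u| ≤ C := by
  obtain ⟨C, hC⟩ := isCompact_Icc.exists_bound_of_continuousOn
    (hs.continuous_value.continuousOn (s := Set.Icc 0 t))
  exact ⟨|C|, abs_nonneg C, fun u h0 h1 => (hC u ⟨h0, h1⟩).trans (le_abs_self C)⟩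

lemma integrable_increment [IsProbabilityMeasure P] [IsProbabilityMeasure ν]
    (hs : IsSupersolution r ν A t h w b k)
    (hp : IsBiddingProcess P r ν ν₀ D X X₀) (hA : MeasurableSet A) (ht : 0 ≤ t) (n : ℕ) :
    Integrable (fun ω => (unsold D X A t n).indicator (fun _ => (1 : ℝ)) ω *
      (stepValue w b (remainingTime D t n ω) (D n ω) (X n ω) - w (remainingTime D t n ω))) P := by
  obtain ⟨C, -, hC⟩ := hs.exists_abs_value_le
  have hτ : Measurable (remainingTime D t n) :=
    measurable_remainingTime fun k _ => hp.measurable_wait k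
  have hU : MeasurableSet (unsold D X A t n) :=
    measurableSet_unsold hA (fun k _ => hp.measurable_wait k) (fun k _ => hp.measurable_offer k)
  have hstep : Measurable fun ω => stepValue w b (remainingTime D t n ω) (D n ω) (X n ω) :=
    (measurable_stepValue (w := w) hs.measurable_bound).comp
      (hτ.prodMk ((hp.measurable_wait n).prodMk (hp.measurable_offer n)))
  have hk := (hp.integrable_comp_offer hs.integrable_dom n).abs
  refine ((integrable_const (|w 0| + C)).add hk).mono'
    ((measurable_const.indicator hU).mul
      (hstep.sub (hs.continuous_value.measurable.comp hτ))).aestronglyMeasurable ?_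
  filter_upwards [hp.ae_wait_pos] with ω hω
  have h1 := abs_stepValue_le (w := w) (x := X n ω) (remainingTime_le ht hω n) (hω n) hs.abs_le
  have h2 := hC _ (remainingTime_nonneg ht n ω) (remainingTime_le ht hω n)
  have h3 : |(unsold D X A t n).indicator (fun _ => (1 : ℝ)) ω| ≤ 1 := by
    by_cases h4 : ω ∈ unsold D X A t n
    · rw [Set.indicator_of_mem h4]; simp
    · rw [Set.indicator_of_notMem h4]; simp
  rw [norm_mul, Real.norm_eq_abs, Real.norm_eq_abs]
  refine (mul_le_of_le_one_left (abs_nonneg _) h3).trans ((abs_sub _ _).trans ?_)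
  simp only [Pi.add_apply]
  linarith

/-- The increments are centred: the next waiting time and offer are independent of the past. -/
lemma integral_increment [IsProbabilityMeasure P] [IsProbabilityMeasure ν]
    (hs : IsSupersolution r ν A t h w b k) (hr : 0 < r)
    (hp : IsBiddingProcess P r ν ν₀ D X X₀) (hA : MeasurableSet A) (ht : 0 ≤ t) (n : ℕ) :
    ∫ ω, (unsold D X A t n).indicator (fun _ => (1 : ℝ)) ω *
      (stepValue w b (remainingTime D t n ω) (D n ω) (X n ω) - w (remainingTime D t n ω)) ∂P
        = 0 := by
  have := isProbabilityMeasure_expMeasure hr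
  have hint := hs.integrable_increment hp hA ht n
  have hτ : Measurable (remainingTime D t n) :=
    measurable_remainingTime fun k _ => hp.measurable_wait k
  have hU : MeasurableSet (unsold D X A t n) :=
    measurableSet_unsold hA (fun k _ => hp.measurable_wait k) (fun k _ => hp.measurable_offer k)
  set U : Ω → ℝ × ℝ := fun ω =>
    (remainingTime D t n ω, (unsold D X A t n).indicator (fun _ => (1 : ℝ)) ω) with hUdef
  set V : Ω → ℝ × ℝ := fun ω => (D n ω, X n ω) with hVdef
  have hUm : Measurable U := hτ.prodMk (measurable_const.indicator hU)
  have hVm : Measurable V := (hp.measurable_wait n).prodMk (hp.measurable_offer n)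
  have hUp : IsProbabilityMeasure (P.map U) := Measure.isProbabilityMeasure_map hUm.aemeasurable
  set F : (ℝ × ℝ) × (ℝ × ℝ) → ℝ := fun q =>
    q.1.2 * (stepValue w b q.1.1 q.2.1 q.2.2 - w q.1.1) with hF
  have hFm : Measurable F := by
    refine (measurable_fst.snd).mul (Measurable.sub ?_
      (hs.continuous_value.measurable.comp measurable_fst.fst))
    exact (measurable_stepValue (w := w) hs.measurable_bound).comp
      (measurable_fst.fst.prodMk measurable_snd)
  have hmap : P.map (fun ω => (U ω, V ω)) = (P.map U).prod ((expMeasure r).prod ν) := by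
    rw [(indepFun_iff_map_prod_eq_prod_map_map hUm.aemeasurable hVm.aemeasurable).1
      (hp.indepFun_past hA t n), hp.map_offer]
  have hint' : Integrable F ((P.map U).prod ((expMeasure r).prod ν)) := by
    rw [← hmap, integrable_map_measure hFm.aestronglyMeasurable (hUm.prodMk hVm).aemeasurable]
    exact hint
  have h1 : ∫ q, F q ∂(P.map fun ω => (U ω, V ω)) = ∫ ω, F (U ω, V ω) ∂P :=
    integral_map (hUm.prodMk hVm).aemeasurable hFm.aestronglyMeasurable
  change ∫ ω, F (U ω, V ω) ∂P = 0
  rw [← h1, hmap, integral_prod _ hint']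
  have h2 : ∀ᵐ p ∂P.map U, 0 ≤ p.1 ∧ p.1 ≤ t := by
    have hset : MeasurableSet {p : ℝ × ℝ | 0 ≤ p.1 ∧ p.1 ≤ t} :=
      (measurableSet_le measurable_const measurable_fst).inter
        (measurableSet_le measurable_fst measurable_const)
    rw [ae_map_iff hUm.aemeasurable hset]
    filter_upwards [hp.ae_wait_pos] with ω hω
    exact ⟨remainingTime_nonneg ht n ω, remainingTime_le ht hω n⟩
  rw [integral_eq_zero_of_ae]
  filter_upwards [h2] with p hpt
  have hstep := integral_stepValue hr hs.continuous_value hs.measurable_bound hs.abs_le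
    hs.integrable_dom hs.hasDeriv hpt.1 hpt.2
  have hsi := integrable_stepValue (w := w) hr hs.measurable_bound hs.abs_le hs.integrable_dom hpt.2
  simp only [hF, Pi.zero_apply]
  rw [integral_const_mul, integral_sub hsi (integrable_const _), hstep]
  simp

lemma integral_interimValue_le [IsProbabilityMeasure P] [IsProbabilityMeasure ν]
    (hs : IsSupersolution r ν A t h w b k) (hr : 0 < r)
    (hp : IsBiddingProcess P r ν ν₀ D X X₀) (hA : MeasurableSet A) (ht : 0 ≤ t)
    (hint : ∀ n, Integrable (interimValue h w D X X₀ A t n) P) (n : ℕ) :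
    ∫ ω, interimValue h w D X X₀ A t n ω ∂P ≤ w t := by
  induction n with
  | zero => simp [interimValue_zero]
  | succ n ih =>
    refine le_trans ?_ ih
    have hinc := hs.integrable_increment hp hA ht n
    calc ∫ ω, interimValue h w D X X₀ A t (n + 1) ω ∂P
        ≤ ∫ ω, (interimValue h w D X X₀ A t n ω +
          (unsold D X A t n).indicator (fun _ => (1 : ℝ)) ω *
            (stepValue w b (remainingTime D t n ω) (D n ω) (X n ω)
              - w (remainingTime D t n ω))) ∂P := by
          refine integral_mono_ae (hint (n + 1)) ((hint n).add hinc) ?_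
          filter_upwards [hp.ae_wait_pos] with ω hω
          exact hs.interimValue_succ_le ht hω n
      _ = ∫ ω, interimValue h w D X X₀ A t n ω ∂P := by
          rw [integral_add (hint n) hinc, hs.integral_increment hr hp hA ht n, add_zero]

lemma measurable_interimValue (hs : IsSupersolution r ν A t h w b k)
    (hp : IsBiddingProcess P r ν ν₀ D X X₀) (hA : MeasurableSet A) (n : ℕ) :
    Measurable (interimValue h w D X X₀ A t n) :=
  _root_.measurable_interimValue hA hp.measurable_wait hp.measurable_offer hs.measurable_reward
    hs.continuous_value.measurable n

/-- The expected reward of a policy is at most the supersolution. -/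
theorem integral_reward_le [IsProbabilityMeasure P] [IsProbabilityMeasure ν]
    (hs : IsSupersolution r ν A t h w b k) (hr : 0 < r)
    (hp : IsBiddingProcess P r ν ν₀ D X X₀) (hA : MeasurableSet A) (ht : 0 ≤ t)
    (h₀ : Integrable h ν₀) (hw₀ : w 0 = ∫ x, h x ∂ν₀)
    (hint : Integrable (fun ω => h (randomSalePrice D X X₀ A t ω)) P) :
    ∫ ω, h (randomSalePrice D X X₀ A t ω) ∂P ≤ w t := by
  classical
  obtain ⟨C, hC0, hC⟩ := hs.exists_abs_value_le
  have hres := hp.integrable_unsold_mul_residual (w := w) (t := t) hA h₀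
  have hfin : Integrable (finalValue h w D X X₀ A t) P := by
    refine (hint.sub hres).congr (ae_of_all _ fun ω => ?_)
    exact sub_eq_iff_eq_add.2 (reward_eq_finalValue_add (h := h) (w := w) ω)
  have h1 : ∫ ω, h (randomSalePrice D X X₀ A t ω) ∂P = ∫ ω, finalValue h w D X X₀ A t ω ∂P := by
    rw [integral_congr_ae (ae_of_all _ fun ω => reward_eq_finalValue_add (w := w) ω), integral_add hfin hres, hp.integral_unsold_mul_residual hA hs.measurable_reward h₀ hw₀, add_zero]
  have hbound : ∀ n, ∀ᵐ ω ∂P, ‖interimValue h w D X X₀ A t n ω‖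
      ≤ C + ‖h (randomSalePrice D X X₀ A t ω)‖ := fun n => by
    filter_upwards [hp.ae_wait_pos] with ω hω
    rw [interimValue]
    split_ifs
    · have := hC _ (remainingTime_nonneg ht n ω) (remainingTime_le ht hω n)
      rw [Real.norm_eq_abs]
      linarith [norm_nonneg (h (randomSalePrice D X X₀ A t ω))]
    · linarith
  have hdom := (integrable_const C).add hint.norm
  have hm := fun n => (hs.measurable_interimValue (X₀ := X₀) hp hA n).aestronglyMeasurable (μ := P)
  rw [h1]
  exact le_of_tendsto' (tendsto_integral_of_dominated_convergence _ hm hdom hbound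
    (hp.tendsto_interimValue hr ht))
    fun n => hs.integral_interimValue_le hr hp hA ht (fun n => hdom.mono' (hm n) (hbound n)) n

/-- If accepted rewards and continuation values are nonnegative, then Fatou's lemma makes the
reward integrable. -/
theorem integrable_reward [IsProbabilityMeasure P] [IsProbabilityMeasure ν]
    (hs : IsSupersolution r ν A t h w b k) (hr : 0 < r)
    (hp : IsBiddingProcess P r ν ν₀ D X X₀) (hA : MeasurableSet A) (ht : 0 ≤ t)
    (h₀ : Integrable h ν₀) (hw : ∀ u, 0 ≤ u → u ≤ t → 0 ≤ w u)
    (hacc : ∀ u, 0 < u → u ≤ t → ∀ x, (u, x) ∈ A → 0 ≤ h x) :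
    Integrable (fun ω => h (randomSalePrice D X X₀ A t ω)) P := by
  classical
  obtain ⟨C, hC0, hC⟩ := hs.exists_abs_value_le
  have hacc' : ∀ n ω, (∀ n, 0 < D n ω) → Accepts A t (fun k => D k ω) (fun k => X k ω) n →
      0 ≤ h (X n ω) ∧ h (X n ω) ≤ |k (X n ω)| := fun n ω hω hn => by
    have h1 : 0 < remainingTime D t (n + 1) ω := hn.1
    have h2 := remainingTime_le ht hω (n + 1)
    refine ⟨hacc _ h1 h2 _ hn.2, (hs.reward_le _ h1 h2 _ hn.2).trans ?_⟩
    exact (le_abs_self _).trans ((hs.abs_le _ h1 h2 _).trans (le_abs_self _))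
  have hm := fun n => (hs.measurable_interimValue (X₀ := X₀) hp hA n).aestronglyMeasurable (μ := P)
  have hnn : ∀ n, ∀ᵐ ω ∂P, 0 ≤ interimValue h w D X X₀ A t n ω := fun n => by
    filter_upwards [hp.ae_wait_pos] with ω hω
    induction n with
    | zero => rw [interimValue_zero]; exact hw t ht le_rfl
    | succ n ih =>
      rw [interimValue_succ]
      split_ifs with h1 h2
      · exact (hacc' n ω hω h2).1
      · exact hw _ (remainingTime_nonneg ht _ ω) (remainingTime_le ht hω _)
      · exact ih
  have hint : ∀ n, Integrable (interimValue h w D X X₀ A t n) P := fun n => by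
    induction n with
    | zero =>
      exact (integrable_const (w t)).congr (ae_of_all _ fun ω => (interimValue_zero ω).symm)
    | succ n ih =>
      have hk := (hp.integrable_comp_offer hs.integrable_dom n).abs
      refine ((ih.norm.add hk).add (integrable_const C)).mono' (hm (n + 1)) ?_
      filter_upwards [hp.ae_wait_pos] with ω hω
      have h3 := norm_nonneg (interimValue h w D X X₀ A t n ω)
      have h4 := abs_nonneg (k (X n ω))
      simp only [Pi.add_apply]
      rw [interimValue_succ]
      split_ifs with h1 h2
      · rw [Real.norm_of_nonneg (hacc' n ω hω h2).1]
        linarith [(hacc' n ω hω h2).2]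
      · rw [Real.norm_eq_abs]
        linarith [hC _ (remainingTime_nonneg ht (n + 1) ω) (remainingTime_le ht hω (n + 1))]
      · linarith
  have hlim := hp.tendsto_interimValue (A := A) (h := h) (w := w) hr ht
  have hfin : Integrable (finalValue h w D X X₀ A t) P := by
    refine ⟨aestronglyMeasurable_of_tendsto_ae _ hm hlim, ?_⟩
    have h1 : ∫⁻ ω, ‖finalValue h w D X X₀ A t ω‖ₑ ∂P
        ≤ liminf (fun n => ∫⁻ ω, ‖interimValue h w D X X₀ A t n ω‖ₑ ∂P) atTop := by
      rw [lintegral_congr_ae (hlim.mono fun ω hω => (hω.enorm.liminf_eq).symm)]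
      exact lintegral_liminf_le' fun n => (hm n).aemeasurable.enorm
    have h2 : ∀ n, ∫⁻ ω, ‖interimValue h w D X X₀ A t n ω‖ₑ ∂P ≤ ENNReal.ofReal (w t) := fun n => by
      rw [lintegral_congr_ae ((hnn n).mono fun ω hω => Real.enorm_of_nonneg hω),
        ← ofReal_integral_eq_lintegral_ofReal (hint n) (hnn n)]
      exact ENNReal.ofReal_le_ofReal (hs.integral_interimValue_le hr hp hA ht hint n)
    exact (h1.trans (liminf_le_of_frequently_le' (Eventually.of_forall h2).frequently)).trans_lt
      ENNReal.ofReal_lt_top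
  refine (hfin.add (hp.integrable_unsold_mul_residual (w := w) (t := t) hA h₀)).congr
    (ae_of_all _ fun ω => ?_)
  simp only [Pi.add_apply]
  rw [← reward_eq_finalValue_add]

/-- If the bound `b` is attained by the policy, then `-w` is a supersolution for the reward `-h`. -/
lemma neg (hs : IsSupersolution r ν A t h w b k)
    (hreward : ∀ u, 0 < u → u ≤ t → ∀ x, (u, x) ∈ A → b u x ≤ h x)
    (hvalue : ∀ u, 0 < u → u ≤ t → ∀ x, (u, x) ∉ A → b u x ≤ w u) :
    IsSupersolution r ν A t (fun x => -h x) (fun u => -w u) (fun u x => -b u x) k where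
  measurable_reward := hs.measurable_reward.neg
  continuous_value := hs.continuous_value.neg
  measurable_bound := hs.measurable_bound.neg
  integrable_dom := hs.integrable_dom
  abs_le u h0 h1 x := by rw [abs_neg]; exact hs.abs_le u h0 h1 x
  hasDeriv u h0 h1 := by
    refine (hs.hasDeriv u h0 h1).neg.congr_deriv ?_
    rw [integral_neg]
    ring
  reward_le u h0 h1 x hx := neg_le_neg (hreward u h0 h1 x hx)
  value_le u h0 h1 x hx := neg_le_neg (hvalue u h0 h1 x hx)

/-- If the bound `b` is attained by the policy, then the expected reward is `w t`: the upper bound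
for the reward `h` is combined with the one for `-h`. -/
theorem integral_reward_eq [IsProbabilityMeasure P] [IsProbabilityMeasure ν]
    (hs : IsSupersolution r ν A t h w b k)
    (hreward : ∀ u, 0 < u → u ≤ t → ∀ x, (u, x) ∈ A → b u x ≤ h x)
    (hvalue : ∀ u, 0 < u → u ≤ t → ∀ x, (u, x) ∉ A → b u x ≤ w u) (hr : 0 < r)
    (hp : IsBiddingProcess P r ν ν₀ D X X₀) (hA : MeasurableSet A) (ht : 0 ≤ t)
    (h₀ : Integrable h ν₀) (hw₀ : w 0 = ∫ x, h x ∂ν₀)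
    (hint : Integrable (fun ω => h (randomSalePrice D X X₀ A t ω)) P) :
    ∫ ω, h (randomSalePrice D X X₀ A t ω) ∂P = w t := by
  refine le_antisymm (hs.integral_reward_le hr hp hA ht h₀ hw₀ hint) ?_
  have h1 := (hs.neg hreward hvalue).integral_reward_le hr hp hA ht h₀.neg
    (by rw [integral_neg, hw₀]) hint.neg
  rw [integral_neg] at h1
  exact neg_le_neg_iff.1 h1

end IsSupersolution

end Verification

/-! ### The optimal threshold policy -/

section Optimal

lemma salePrice_congr {A A' : Set (ℝ × ℝ)} {t : ℝ} {d x : ℕ → ℝ} (x₀ : ℝ)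
    (h : ∀ n, Accepts A t d x n ↔ Accepts A' t d x n) :
    salePrice A t d x x₀ = salePrice A' t d x x₀ := by
  classical
  unfold salePrice
  by_cases h1 : ∃ n, Accepts A t d x n
  · have h2 : ∃ n, Accepts A' t d x n := h1.imp fun n => (h n).1
    rw [dif_pos h1, dif_pos h2]
    exact congrArg x (Nat.find_congr' (h _))
  · have h2 : ¬ ∃ n, Accepts A' t d x n := fun h2 => h1 (h2.imp fun n => (h n).2)
    rw [dif_neg h1, dif_neg h2]

/-- Only the values of the threshold at positive times matter. -/
lemma salePrice_thresholdPolicy_congr {m m' : ℝ → ℝ} (h : ∀ s, 0 < s → m s = m' s) (t : ℝ)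
    (d x : ℕ → ℝ) (x₀ : ℝ) :
    salePrice (thresholdPolicy m) t d x x₀ = salePrice (thresholdPolicy m') t d x x₀ := by
  refine salePrice_congr x₀ fun n => and_congr_right fun h0 => ?_
  simp only [thresholdPolicy, Set.mem_ofPred_eq]
  rw [h _ h0]

lemma measurableSet_thresholdPolicy {m : ℝ → ℝ} (hm : Measurable m) :
    MeasurableSet (thresholdPolicy m) :=
  measurableSet_le (hm.comp measurable_fst) measurable_snd

variable {r : ℝ} {ν : Measure ℝ} [IsProbabilityMeasure ν] {m : ℝ → ℝ}

/-- The threshold bounds the expected price of every policy: an offer `x` at time `u` is worth at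
most `max x (m u)`, and `E[max X₁ (m u)] = m u + φ(m u)`. -/
lemma isSupersolution_threshold (hν : Integrable (fun x : ℝ => max x 0) ν) (A : Set (ℝ × ℝ))
    (t : ℝ) (hmono : Monotone m) (hmc : Continuous m) (hm0 : 0 ≤ m 0)
    (hm : ∀ t, 0 ≤ t → HasDerivAt m (r * tailIntegral ν (m t)) t) :
    IsSupersolution r ν A t (fun x => x) m (fun u x => max x (m u)) (fun x => max x 0 + m t) where
  measurable_reward := measurable_id
  continuous_value := hmc
  measurable_bound := by
    have := hmc.measurable
    exact measurable_snd.max (this.comp measurable_fst)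
  integrable_dom := hν.add (integrable_const _)
  abs_le u h0 h1 x := by
    have h2 := hm0.trans (hmono h0.le)
    have h3 := hmono h1
    rw [abs_of_nonneg (h2.trans (le_max_right _ _))]
    exact max_le (by linarith [le_max_left x 0]) (by linarith [le_max_right x 0])
  hasDeriv u h0 h1 := by
    refine (hm u h0.le).hasDerivWithinAt.congr_deriv ?_
    have h2 : ∀ x, max x (m u) = m u + max (x - m u) 0 := fun x => by
      rw [← max_add_add_left]; simp
    simp_rw [h2]
    rw [integral_add (integrable_const _) (integrable_posPart_sub hν _),
      ← tailIntegral_eq_integral_posPart hν]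
    simp
  reward_le u _ _ x _ := le_max_left _ _
  value_le u _ _ x _ := le_max_right _ _

/-- Value of an offer under the threshold policy when the reward is the square of the price. -/
noncomputable def squareBound (m v : ℝ → ℝ) (u x : ℝ) : ℝ :=
  if m u ≤ x then x ^ 2 else v u

lemma integral_squareBound (hν : Integrable (fun x : ℝ => max x 0) ν)
    (hint : ∀ x, IntegrableOn (tailIntegral ν) (Set.Ioi x)) (v : ℝ → ℝ) (u : ℝ) :
    ∫ x, squareBound m v u x ∂ν = 2 * (∫ y in Set.Ioi (m u), tailIntegral ν y)
      + 2 * m u * tailIntegral ν (m u) + (m u ^ 2 - v u) * ν.real (Set.Ici (m u)) + v u := by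
  have h1 : ∀ x, squareBound m v u x = (max (x - m u) 0) ^ 2 + 2 * m u * max (x - m u) 0
      + (Set.Ici (m u)).indicator (fun _ => m u ^ 2 - v u) x + v u := fun x => by
    rw [squareBound]
    split_ifs with h
    · rw [max_eq_left (by linarith), Set.indicator_of_mem (Set.mem_Ici.2 h)]
      ring
    · rw [max_eq_right (by linarith), Set.indicator_of_notMem (by simpa using h)]
      ring
  simp_rw [h1]
  have i1 := integrable_sq_posPart_sub hν (hint (m u))
  have i2 := (integrable_posPart_sub hν (m u)).const_mul (2 * m u)
  have i3 : Integrable ((Set.Ici (m u)).indicator fun _ => m u ^ 2 - v u) ν :=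
    (integrable_const _).indicator measurableSet_Ici
  have i12 : Integrable (fun x => (max (x - m u) 0) ^ 2 + 2 * m u * max (x - m u) 0) ν := i1.add i2
  have i123 : Integrable (fun x => (max (x - m u) 0) ^ 2 + 2 * m u * max (x - m u) 0
      + (Set.Ici (m u)).indicator (fun _ => m u ^ 2 - v u) x) ν := i12.add i3
  rw [integral_add i123 (integrable_const _), integral_add i12 i3,
    integral_add i1 i2, integral_sq_posPart_sub hν, integral_const_mul,
    ← tailIntegral_eq_integral_posPart hν, integral_indicator measurableSet_Ici]
  simp
  ring

/-- The second moment `m² + σ²` of the price under the threshold policy is a supersolution for the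
reward `x²`: the left derivatives of `m²` and `σ²` add up to `r (E[squareBound] - (m² + σ²))`. -/
lemma isSupersolution_square (hν : Integrable (fun x : ℝ => max x 0) ν) (hM : offerSup ν = ⊤)
    (hint : ∀ x, IntegrableOn (tailIntegral ν) (Set.Ioi x)) (t s : ℝ)
    (hmono : StrictMono m) (hmc : Continuous m) (hm0 : 0 ≤ m 0)
    (hm : ∀ t, 0 ≤ t → HasDerivAt m (r * tailIntegral ν (m t)) t) :
    ∃ k, IsSupersolution r ν (thresholdPolicy m) t (fun x => x ^ 2)
      (fun u => m u ^ 2 + varianceSolution (tailIntegral ν)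
        (fun x => ∫ y in Set.Ioi x, tailIntegral ν y) m r s u)
      (squareBound m fun u => m u ^ 2 + varianceSolution (tailIntegral ν)
        (fun x => ∫ y in Set.Ioi x, tailIntegral ν y) m r s u) k := by
  have hφ := continuous_tailIntegral hν
  have hφpos := tailIntegral_pos hν hM
  have hΦ : Continuous fun x => ∫ y in Set.Ioi x, tailIntegral ν y :=
    continuous_iff_continuousAt.2 fun x => (hasDerivAt_integral_tailIntegral hν hint x).continuousAt
  set σ := varianceSolution (tailIntegral ν) (fun x => ∫ y in Set.Ioi x, tailIntegral ν y) m r s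
    with hσ
  have hσc : Continuous σ := continuous_varianceSolution s hφ hφpos hΦ hmc
  set v : ℝ → ℝ := fun u => m u ^ 2 + σ u with hv
  have hvc : Continuous v := (hmc.pow 2).add hσc
  obtain ⟨C, hC⟩ := isCompact_Icc.exists_bound_of_continuousOn (hvc.continuousOn (s := Set.Icc 0 t))
  -- Accepted prices are nonnegative, so negative offers, whose square may fail to be integrable,
  -- do not contribute.
  refine ⟨fun x => (max (x - 0) 0) ^ 2 + |C|, ?_⟩
  exact {
    measurable_reward := by fun_prop
    continuous_value := hvc
    measurable_bound := by
      have h1 := hmc.measurable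
      have h2 := hvc.measurable
      exact Measurable.ite (measurableSet_le (h1.comp measurable_fst) measurable_snd)
        (by fun_prop) (h2.comp measurable_fst)
    integrable_dom := (integrable_sq_posPart_sub hν (hint 0)).add (integrable_const _)
    abs_le := fun u h0 h1 x => by
      rw [squareBound, sub_zero]
      split_ifs with h2
      · have h3 : 0 ≤ x := (hm0.trans (hmono.monotone h0.le)).trans h2
        rw [max_eq_left h3, abs_of_nonneg (sq_nonneg x)]
        linarith [abs_nonneg C]
      · have h3 := (hC u ⟨h0.le, h1⟩).trans (le_abs_self C)
        rw [Real.norm_eq_abs] at h3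
        linarith [sq_nonneg (max x 0)]
    hasDeriv := fun u h0 h1 => by
      have h2 := hasDerivWithinAt_varianceSolution (r := r) s h0.le hφ hφpos hΦ hmc hmono hm
        (hasDerivWithinAt_tailIntegral_left hν)
      refine (((hm u h0.le).pow 2).hasDerivWithinAt.add h2).congr_deriv ?_
      rw [integral_squareBound hν hint]
      simp only [hv, hσ]
      push_cast
      ring
    reward_le := fun u _ _ x hx => by
      rw [squareBound, if_pos (show m u ≤ x from hx)]
    value_le := fun u _ _ x hx => by
      rw [squareBound, if_neg (show ¬ m u ≤ x from hx)] }

end Optimal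

theorem mainTheorem9 {Ω : Type*} [MeasurableSpace Ω] (P : Measure Ω) [IsProbabilityMeasure P]
    (r : ℝ) (hr : 0 < r)
    (ν ν₀ : Measure ℝ) [IsProbabilityMeasure ν] [IsProbabilityMeasure ν₀]
    (D X : ℕ → Ω → ℝ) (X₀ : Ω → ℝ)
    (hproc : IsBiddingProcess P r ν ν₀ D X X₀)
    (hν : Integrable (fun x : ℝ => max x 0) ν)
    (hν₀ : Integrable (fun x : ℝ => x) ν₀)
    (hμ₀ : 0 ≤ ∫ x, x ∂ν₀)
    (hM : offerSup ν = ⊤)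
    (c : ℝ) (hc : 0 < c)
    (htail : Tendsto (fun x : ℝ => tailIntegral ν x / ∫ u in Set.Ioi x, tailIntegral ν u)
      atTop (𝓝 c)) :
    (∀ t : ℝ, 0 ≤ t →
      IsLUB (expectedPrices P D X X₀ t) (optimalThreshold P D X X₀ t) ∧
      Integrable (optimalSalePrice P D X X₀ t) P ∧
      ∫ ω, optimalSalePrice P D X X₀ t ω ∂P = optimalThreshold P D X X₀ t) ∧
    (∀ t : ℝ, 0 < t → DifferentiableAt ℝ (optimalThreshold P D X X₀) t) ∧
    Asymptotics.IsEquivalent atTop (optimalThreshold P D X X₀)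
      (fun t : ℝ => 1 / c * Real.log t) ∧
    Asymptotics.IsEquivalent atTop (deriv (optimalThreshold P D X X₀))
      (fun t : ℝ => 1 / (c * t)) ∧
    (MemLp (fun x : ℝ => x) 2 ν₀ →
      (∀ t : ℝ, 0 ≤ t → MemLp (optimalSalePrice P D X X₀ t) 2 P) ∧
      Tendsto (fun t : ℝ => variance (optimalSalePrice P D X X₀ t) P) atTop
        (𝓝 (2 / c ^ 2))) := by
  have hφ := continuous_tailIntegral hν
  have hφpos := tailIntegral_pos hν hM
  have hint := integrableOn_tailIntegral hν hc htail
  have hΦ := hasDerivAt_integral_tailIntegral hν hint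
  have hΦc : Continuous fun x => ∫ y in Set.Ioi x, tailIntegral ν y :=
    continuous_iff_continuousAt.2 fun x => (hΦ x).continuousAt
  have hΦpos := integral_tailIntegral_pos hν hM hint
  obtain ⟨m, hmono, hmc, hm0, hmtop, hm⟩ :=
    exists_threshold hφ hφpos (antitone_tailIntegral hν) (∫ x, x ∂ν₀) hr
  have hm0' : 0 ≤ m 0 := hm0 ▸ hμ₀
  have hmnn : ∀ u, 0 ≤ u → 0 ≤ m u := fun u hu => hm0'.trans (hmono.monotone hu)
  set A := thresholdPolicy m with hAdef
  have hA : MeasurableSet A := measurableSet_thresholdPolicy hmc.measurable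
  have hsol := fun (B : Set (ℝ × ℝ)) t =>
    isSupersolution_threshold hν B t hmono.monotone hmc hm0' hm
  have hSint : ∀ t, 0 ≤ t → Integrable (randomSalePrice D X X₀ A t) P := fun t ht =>
    (hsol A t).integrable_reward hr hproc hA ht hν₀ (fun u h0 _ => hmnn u h0)
      fun u h0 _ x hx => (hmnn u h0.le).trans hx
  have hSmean : ∀ t, 0 ≤ t → ∫ ω, randomSalePrice D X X₀ A t ω ∂P = m t := fun t ht =>
    (hsol A t).integral_reward_eq (fun u _ _ x hx => max_le le_rfl hx)
      (fun u _ _ x hx => max_le (not_le.1 hx).le le_rfl) hr hproc hA ht hν₀ hm0 (hSint t ht)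
  have hLUB : ∀ t, 0 ≤ t → IsLUB (expectedPrices P D X X₀ t) (m t) := fun t ht => by
    refine IsGreatest.isLUB ⟨⟨A, hA, hSint t ht, (hSmean t ht).symm⟩, ?_⟩
    rintro _ ⟨B, hB, hBint, rfl⟩
    exact (hsol B t).integral_reward_le hr hproc hB ht hν₀ hm0 hBint
  have hopt : ∀ t, 0 ≤ t → optimalThreshold P D X X₀ t = m t := fun t ht =>
    (hLUB t ht).csSup_eq (hLUB t ht).nonempty
  -- Below time `0` the two thresholds may differ, but no offer is accepted there.
  have hS : ∀ t, optimalSalePrice P D X X₀ t = randomSalePrice D X X₀ A t := fun t =>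
    funext fun ω => salePrice_thresholdPolicy_congr (fun s hs => hopt s hs.le) t _ _ _
  have hderiv : ∀ t, 0 < t →
      HasDerivAt (optimalThreshold P D X X₀) (r * tailIntegral ν (m t)) t := fun t ht => by
    refine (hm t ht.le).congr_of_eventuallyEq ?_
    filter_upwards [lt_mem_nhds ht] with s hs
    exact hopt s hs.le
  have hlim := tendsto_mul_tail_threshold hr hc hΦpos hΦ htail hm hmtop
  refine ⟨fun t ht => ?_, fun t ht => (hderiv t ht).differentiableAt, ?_, ?_, fun hsq => ?_⟩
  · rw [hS, hopt t ht]
    exact ⟨hLUB t ht, hSint t ht, hSmean t ht⟩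
  · refine (isEquivalent_threshold hr hc hlim hm).congr_left ?_
    filter_upwards [eventually_ge_atTop 0] with t ht
    exact (hopt t ht).symm
  · refine (isEquivalent_deriv_threshold hr hc hlim).congr_left ?_
    filter_upwards [eventually_gt_atTop 0] with t ht
    exact (hderiv t ht).deriv.symm
  · have hsq' : Integrable (fun x : ℝ => x ^ 2) ν₀ :=
      (memLp_two_iff_integrable_sq hν₀.aestronglyMeasurable).1 hsq
    set s : ℝ := ∫ x, x ^ 2 ∂ν₀ - (∫ x, x ∂ν₀) ^ 2 with hs
    have hs0 : 0 ≤ s := by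
      have h1 := variance_eq_sub hsq
      have h2 := variance_nonneg (fun x : ℝ => x) ν₀
      rw [h1] at h2
      exact h2
    set σ := varianceSolution (tailIntegral ν) (fun x => ∫ y in Set.Ioi x, tailIntegral ν y) m r s
      with hσ
    have hσ0 : ∀ u, 0 ≤ u → 0 ≤ σ u := fun u hu => varianceSolution_nonneg hr hs0 hu hφpos hΦpos
    have hw0 : m 0 ^ 2 + σ 0 = ∫ x, x ^ 2 ∂ν₀ := by
      rw [hσ, varianceSolution_zero hφpos, hm0, hs]
      ring
    have hSsq : ∀ t, 0 ≤ t → Integrable (fun ω => randomSalePrice D X X₀ A t ω ^ 2) P ∧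
        ∫ ω, randomSalePrice D X X₀ A t ω ^ 2 ∂P = m t ^ 2 + σ t := fun t ht => by
      obtain ⟨k, hk⟩ := isSupersolution_square hν hM hint t s hmono hmc hm0' hm
      have hi := hk.integrable_reward hr hproc hA ht hsq'
        (fun u h0 _ => add_nonneg (sq_nonneg _) (hσ0 u h0)) fun u _ _ x _ => sq_nonneg x
      refine ⟨hi, hk.integral_reward_eq (fun u _ _ x hx => ?_) (fun u _ _ x hx => ?_)
        hr hproc hA ht hsq' hw0 hi⟩
      · rw [squareBound, if_pos (show m u ≤ x from hx)]
      · rw [squareBound, if_neg (show ¬ m u ≤ x from hx)]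
    have hSL : ∀ t, 0 ≤ t → MemLp (randomSalePrice D X X₀ A t) 2 P := fun t ht =>
      (memLp_two_iff_integrable_sq (hSint t ht).aestronglyMeasurable).2 (hSsq t ht).1
    refine ⟨fun t ht => hS t ▸ hSL t ht, ?_⟩
    refine (tendsto_varianceSolution hr hc s hφ hφpos hΦc hmc htail hmtop hlim).congr' ?_
    filter_upwards [eventually_ge_atTop 0] with t ht
    rw [hS, variance_eq_sub (hSL t ht), hSmean t ht]
    have := (hSsq t ht).2
    simp only [Pi.pow_apply]
    rw [this]
    ring
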